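/- Let $k$ be a commutative ring with unit, $A$ and $B$ unital associative $k$-algebras, $M$ an $(A,B)$-bimodule on which $k$ acts centrally, $E=\begin{pmatrix}A&M\\0&B\end{pmatrix}$ the triangular matrix algebra, and $X$ an $E$-bimodule on which $k$ acts centrally. Let $1_A,1_B\in E$ be the units of $A$ and $B$, viewed as idempotents of $E$, and put $X_{AA}=1_AX1_A$ (an $A$-bimodule) and $X1_B$ (a left $E$-module and right $B$-module, that is, an $E\otimes_k B^{\mathrm{op}}$-module). Let $B_E$ denote $B$ regarded as an $E\otimes_k B^{\mathrm{op}}$-module, with $E$ acting on the left through the projection $E\to B$, $\begin{pmatrix}a&m\\0&b\end{pmatrix}\mapsto b$, and $B$ acting on the right by multiplication. Let $\mathrm H^n(C,Y)$ denote the Hochschild cohomology of a $k$-algebra $C$ with coefficients in a $C$-bimodule $Y$, that is, the cohomology of the complex of $k$-multilinear maps $C^n\to Y$ with the Hochschild coboundary. Let $\operatorname{Ext}^n_{R,k}(N,Y)$ denote the Ext groups of the module $N$ over a $k$-algebra $R$ relative to the family of the $R$-linear epimorphisms which split as $k$-linear maps, that is, the cohomology of $\operatorname{Hom}_R(P_*,Y)$,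 where $P_*\to N$ is a resolution that is contractible as a complex of $k$-modules and whose terms $P_n$ are projective relative to that family. Then there exists a long exact sequence of $k$-modules $$0\to \operatorname{Ext}^0_{E\otimes B^{\mathrm{op}},k}(B_E,X1_B)\to \mathrm H^0(E,X)\to \mathrm H^0(A,X_{AA})\to \operatorname{Ext}^1_{E\otimes B^{\mathrm{op}},k}(B_E,X1_B)\to \mathrm H^1(E,X)\to \mathrm H^1(A,X_{AA})\to\cdots$$ continuing through all degrees $n\ge 0$. -/

import Mathlib

open MulOpposite TensorProduct

/-! ### Cohomology of a cochain complex of modules -/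

section Cohomology

variable {k : Type*} [CommRing k] {C : ℕ → Type*} [∀ n, AddCommGroup (C n)]
  [∀ n, Module k (C n)]

/-- The coboundaries in degree `n` of `0 → C⁰ → C¹ → ⋯`. -/
def coboundaries (d : ∀ n, C n →ₗ[k] C (n + 1)) : ∀ n, Submodule k (C n)
  | 0 => ⊥
  | n + 1 => LinearMap.range (d n)

/-- The `n`-th cohomology (cocycles modulo coboundaries) of `0 → C⁰ → C¹ → ⋯`. -/
abbrev Cohomology (d : ∀ n, C n →ₗ[k] C (n + 1)) (n : ℕ) : Type _ :=
  LinearMap.ker (d n) ⧸ (coboundaries d n).submoduleOf (LinearMap.ker (d n))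

end Cohomology

/-! ### Hochschild cohomology -/

namespace Hochschild

section

variable {A : Type*} [Mul A] {n : ℕ}

theorem contractNth_update [DecidableEq (Fin n)] [DecidableEq (Fin (n + 1))]
    (j : Fin n) (g : Fin (n + 1) → A) (i : Fin (n + 1)) :
    ∃ (l : Fin n) (p : A → A),
      (p = id ∨ (∃ c, p = fun x => x * c) ∨ ∃ c, p = fun x => c * x) ∧
      ∀ x, Fin.contractNth j.castSucc (· * ·) (Function.update g i x) =
        Function.update (Fin.contractNth j.castSucc (· * ·) g) l (p x) := by
  rcases lt_trichotomy (i : ℕ) (j : ℕ) with h | h | h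
  · refine ⟨⟨i, by omega⟩, id, Or.inl rfl, fun x => ?_⟩
    funext q
    simp only [Fin.contractNth, Function.update_apply, Fin.ext_iff, Fin.val_castSucc, Fin.val_succ, id]
    grind
  · refine ⟨j, fun x => x * g j.succ, Or.inr (Or.inl ⟨_, rfl⟩), fun x => ?_⟩
    funext q
    simp only [Fin.contractNth, Function.update_apply, Fin.ext_iff, Fin.val_castSucc, Fin.val_succ]
    split_ifs <;> grind
  · by_cases h' : (i : ℕ) = j + 1
    · refine ⟨j, fun x => g j.castSucc * x, Or.inr (Or.inr ⟨_, rfl⟩), fun x => ?_⟩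
      funext q
      simp only [Fin.contractNth, Function.update_apply, Fin.ext_iff, Fin.val_castSucc, Fin.val_succ]
      split_ifs <;> grind
    · refine ⟨⟨i - 1, by omega⟩, id, Or.inl rfl, fun x => ?_⟩
      funext q
      simp only [Fin.contractNth, Function.update_apply, Fin.ext_iff, Fin.val_castSucc, Fin.val_succ, id]
      grind

end

set_option linter.unusedSectionVars false

variable {k A X : Type*} [CommRing k] [Ring A] [Algebra k A]
  [AddCommGroup X] [Module k X] [Module A X] [Module Aᵐᵒᵖ X] [SMulCommClass A Aᵐᵒᵖ X]
  [IsScalarTower k A X] [IsScalarTower k Aᵐᵒᵖ X]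

/-- `(a₀, …, aₙ) ↦ a₀ · f(a₁, …, aₙ)`. -/
def faceFirst {n : ℕ} (f : MultilinearMap k (fun _ : Fin n => A) X) :
    MultilinearMap k (fun _ : Fin (n + 1) => A) X :=
  LinearMap.uncurryLeft (M := fun _ : Fin (n + 1) => A)
    { toFun := fun a => a • f
      map_add' := fun a b => add_smul a b f
      map_smul' := fun c a => by ext g; exact smul_assoc c a (f g) }

/-- `(a₀, …, aₙ) ↦ f(a₀, …, aⱼaⱼ₊₁, …, aₙ)`. -/
def faceMul {n : ℕ} (f : MultilinearMap k (fun _ : Fin n => A) X) (j : Fin n) :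
    MultilinearMap k (fun _ : Fin (n + 1) => A) X where
  toFun g := f (Fin.contractNth j.castSucc (· * ·) g)
  map_update_add' g i x y := by
    obtain ⟨l, p, hp, h⟩ := contractNth_update j g i
    rw [h, h, h, ← MultilinearMap.map_update_add]
    congr 2
    rcases hp with rfl | ⟨c, rfl⟩ | ⟨c, rfl⟩ <;> simp [add_mul, mul_add]
  map_update_smul' g i c x := by
    obtain ⟨l, p, hp, h⟩ := contractNth_update j g i
    rw [h, h, ← MultilinearMap.map_update_smul]
    congr 2
    rcases hp with rfl | ⟨c, rfl⟩ | ⟨c, rfl⟩ <;> simp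

/-- `(a₀, …, aₙ) ↦ f(a₀, …, aₙ₋₁) · aₙ`. -/
def faceLast {n : ℕ} (f : MultilinearMap k (fun _ : Fin n => A) X) :
    MultilinearMap k (fun _ : Fin (n + 1) => A) X :=
  MultilinearMap.uncurryRight (M := fun _ : Fin (n + 1) => A)
    { toFun := fun g =>
        { toFun := fun a => op a • f g
          map_add' := fun a b => by rw [op_add, add_smul]
          map_smul' := fun c a => by rw [op_smul, smul_assoc, RingHom.id_apply] }
      map_update_add' := fun g i x y => by ext a; simp
      map_update_smul' := fun g i c x => by
        ext a
        simp [smul_comm (op a) c] }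

/-- The Hochschild coboundary:
`(df)(a₀, …, aₙ) = a₀ f(a₁, …, aₙ) + ∑ⱼ (-1)ʲ⁺¹ f(a₀, …, aⱼaⱼ₊₁, …, aₙ) + (-1)ⁿ⁺¹ f(a₀, …, aₙ₋₁) aₙ`. -/
def d (k A X : Type*) [CommRing k] [Ring A] [Algebra k A]
    [AddCommGroup X] [Module k X] [Module A X] [Module Aᵐᵒᵖ X]
    [IsScalarTower k A X] [IsScalarTower k Aᵐᵒᵖ X] (n : ℕ) :
    MultilinearMap k (fun _ : Fin n => A) X →ₗ[k] MultilinearMap k (fun _ : Fin (n + 1) => A) X where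
  toFun f := faceFirst f + ∑ j : Fin n, (-1 : k) ^ ((j : ℕ) + 1) • faceMul f j
    + (-1 : k) ^ (n + 1) • faceLast f
  map_add' f f' := by
    ext g
    simp [faceFirst, faceMul, faceLast, Finset.sum_add_distrib]
    abel
  map_smul' c f := by
    ext g
    simp [faceFirst, faceMul, faceLast, Finset.smul_sum, smul_add, smul_smul, smul_comm _ c, mul_comm c]

theorem d_apply {n : ℕ} (f : MultilinearMap k (fun _ : Fin n => A) X) (g : Fin (n + 1) → A) :
    d k A X n f g = g 0 • f (Fin.tail g) +
      ∑ j : Fin n, (-1 : k) ^ ((j : ℕ) + 1) • f (Fin.contractNth j.castSucc (· * ·) g) +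
      (-1 : k) ^ (n + 1) • op (g (Fin.last n)) • f (Fin.init g) := by
  simp [d, faceFirst, faceMul, faceLast]


theorem contractNth_contractNth {A : Type*} [Semigroup A] {n : ℕ} (h : Fin (n + 3) → A)
    (i j : Fin (n + 1)) (hij : (i : ℕ) ≤ j) :
    Fin.contractNth j.castSucc (· * ·) (Fin.contractNth i.castSucc.castSucc (· * ·) h) =
      Fin.contractNth i.castSucc (· * ·) (Fin.contractNth j.succ.castSucc (· * ·) h) := by
  funext q
  simp only [Fin.contractNth, Fin.val_castSucc, Fin.val_succ, Fin.castSucc_succ]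
  split_ifs <;> first | rfl | omega | simp [mul_assoc]

/-- `(a₀, …, aₙ₊₁) ↦ a₀ · f(a₁, …, aₙ) · aₙ₊₁`. -/
def sandwich {n : ℕ} (f : (Fin n → A) → X) (h : Fin (n + 2) → A) : X :=
  h 0 • op (h (Fin.last _)) • f (fun i => h i.succ.castSucc)

theorem sandwich_d {n : ℕ} (f : MultilinearMap k (fun _ : Fin n => A) X) (h : Fin (n + 3) → A) :
    sandwich (d k A X n f) h =
      ∑ i : Fin (n + 2), (-1 : k) ^ (i : ℕ) • sandwich f (Fin.contractNth i.castSucc (· * ·) h) := by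
  have e1 : sandwich f (Fin.contractNth (0 : Fin (n+2)).castSucc (· * ·) h) =
      h 0 • op (h (Fin.last _)) • h 1 • f (fun i => h i.succ.succ.castSucc) := by
    unfold sandwich
    have : (fun i : Fin n => Fin.contractNth (0 : Fin (n+2)).castSucc (· * ·) h i.succ.castSucc) =
      (fun i => h i.succ.succ.castSucc) := by
      funext q; simp [Fin.contractNth]
    rw [this]
    rw [← smul_comm (h 1) (op _), smul_smul]
    simp [Fin.contractNth]
  have e2 : sandwich f (Fin.contractNth (Fin.last (n+1)).castSucc (· * ·) h) =
      h 0 • op (h (Fin.last _)) • op (h (Fin.last (n+1)).castSucc) •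
        f (fun i => h i.succ.castSucc.castSucc) := by
    unfold sandwich
    have : (fun i : Fin n => Fin.contractNth (Fin.last (n+1)).castSucc (· * ·) h i.succ.castSucc) =
      (fun i => h i.succ.castSucc.castSucc) := by
      funext q; simp [Fin.contractNth]
    rw [this]
    rw [smul_smul (op _), ← op_mul]
    simp [Fin.contractNth]
  have e3 : ∀ j : Fin n, sandwich f (Fin.contractNth j.succ.castSucc.castSucc (· * ·) h) =
      h 0 • op (h (Fin.last _)) •
        f (Fin.contractNth j.castSucc (· * ·) (fun i => h i.succ.castSucc)) := by
    intro j
    unfold sandwich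
    have : (fun i : Fin n => Fin.contractNth j.succ.castSucc.castSucc (· * ·) h i.succ.castSucc) =
      Fin.contractNth j.castSucc (· * ·) (fun i => h i.succ.castSucc) := by
      funext q
      simp [Fin.contractNth]
    rw [this]
    have : ¬ (n + 1 < (j:ℕ) + 1) := by omega
    have h2 : ¬ (n  = (j:ℕ) ) := by omega
    simp [Fin.contractNth, this, h2]
  rw [Fin.sum_univ_succ, Fin.sum_univ_castSucc]
  simp only [Fin.succ_castSucc, Fin.succ_last, e1, e2, e3]
  rw [sandwich, d_apply]
  simp only [smul_add, Finset.smul_sum, smul_comm _ ((-1 : k) ^ _)]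
  simp [add_assoc]
  rfl

theorem d_comp_d (n : ℕ) : d k A X (n + 1) ∘ₗ d k A X n = 0 := by
  ext f g
  have key : ∀ h : Fin (n + 4) → A, sandwich (d k A X (n + 1) (d k A X n f)) h = 0 := by
    intro h
    rw [sandwich_d]
    simp only [sandwich_d, Finset.smul_sum, smul_smul]
    rw [← Finset.sum_product', Finset.univ_product_univ]
    let s : Finset (Fin (n + 3) × Fin (n + 2)) := {p | (p.1 : ℕ) ≤ (p.2 : ℕ)}
    rw [← Finset.sum_add_sum_compl s, ← eq_neg_iff_add_eq_zero, ← Finset.sum_neg_distrib]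
    refine Finset.sum_bij' (i := fun p hp => (p.2.succ, p.1.castLT (by simp [s] at hp; omega)))
      (j := fun p hp => (p.2.castSucc, p.1.pred (by simp [s] at hp; intro h; simp [h] at hp))) ?_ ?_ ?_ ?_ ?_
    · rintro ⟨i, j⟩ hp
      simp [s] at hp ⊢; omega
    · rintro ⟨i, j⟩ hp
      simp [s] at hp ⊢; omega
    · rintro ⟨i, j⟩ hp
      simp 
    · rintro ⟨i, j⟩ hp
      simp 
    · rintro ⟨i, j⟩ hp
      simp [s] at hp
      have := contractNth_contractNth h (i.castLT (by omega)) j (by simpa using hp)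
      simp only [Fin.castSucc_castLT] at this
      rw [this, ← neg_smul]
      congr 1
      simp [pow_add]
      ring
  have := key (Fin.cons 1 (Fin.snoc g 1 : Fin (n + 3) → A))
  simpa [sandwich] using this

/-- The Hochschild cohomology `Hⁿ(A, X)` of the `k`-algebra `A` with coefficients in the
`A`-bimodule `X`. -/
abbrev H (k A X : Type*) [CommRing k] [Ring A] [Algebra k A]
    [AddCommGroup X] [Module k X] [Module A X] [Module Aᵐᵒᵖ X]
    [IsScalarTower k A X] [IsScalarTower k Aᵐᵒᵖ X] (n : ℕ) : Type _ :=
  Cohomology (d k A X) n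

end Hochschild

/-! ### Ext relative to the `k`-split epimorphisms -/

universe u v w x

section Relative

variable (k : Type u) [CommRing k] (R : Type v) [Ring R] [Algebra k R]

/-- `P` is projective relative to the family of the `R`-linear epimorphisms which split as
`k`-linear maps: every `R`-linear map out of `P` lifts through each of them. -/
def IsRelProjective (P : Type w) [AddCommGroup P] [Module R P] : Prop :=
  ∀ (Y Z : Type (max v w)) [AddCommGroup Y] [AddCommGroup Z] [Module k Y] [Module k Z]
    [Module R Y] [Module R Z] [IsScalarTower k R Y] [IsScalarTower k R Z] (g : Y →ₗ[R] Z),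
    (∃ s : Z →ₗ[k] Y, ∀ z, g (s z) = z) →
      ∀ f : P →ₗ[R] Z, ∃ f' : P →ₗ[R] Y, g ∘ₗ f' = f

/-- A projective resolution `⋯ → P₁ → P₀ → N → 0` of the `R`-module `N`, relative to the family of
the `R`-linear epimorphisms which split as `k`-linear maps: a complex of relative projective
`R`-modules over `N` that is contractible as a complex of `k`-modules. -/
structure RelProjResolution (N : Type w) [AddCommGroup N] [Module k N] [Module R N] where
  P : ℕ → Type x
  [addCommGroup : ∀ n, AddCommGroup (P n)]
  [moduleBase : ∀ n, Module k (P n)]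
  [module : ∀ n, Module R (P n)]
  [tower : ∀ n, IsScalarTower k R (P n)]
  relProjective : ∀ n, IsRelProjective k R (P n)
  d : ∀ n, P (n + 1) →ₗ[R] P n
  aug : P 0 →ₗ[R] N
  aug_comp_d : aug ∘ₗ d 0 = 0
  d_comp_d : ∀ n, d n ∘ₗ d (n + 1) = 0
  contractible : ∃ (t : N →ₗ[k] P 0) (s : ∀ n, P n →ₗ[k] P (n + 1)),
    (∀ y, aug (t y) = y) ∧
    (∀ y, d 0 (s 0 y) + t (aug y) = y) ∧
    ∀ n y, d (n + 1) (s (n + 1) y) + s n (d n y) = y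

attribute [instance] RelProjResolution.addCommGroup RelProjResolution.moduleBase
  RelProjResolution.module RelProjResolution.tower

namespace RelProjResolution

variable {k R}
variable {N : Type w} [AddCommGroup N] [Module k N] [Module R N]

/-- The coboundary of the complex `Hom_R(P, Y)`. -/
def homD (Q : RelProjResolution k R N)
    (Y : Type*) [AddCommGroup Y] [Module k Y] [Module R Y] [IsScalarTower k R Y] (n : ℕ) :
    (Q.P n →ₗ[R] Y) →ₗ[k] (Q.P (n + 1) →ₗ[R] Y) where
  toFun f := f ∘ₗ Q.d n
  map_add' _ _ := LinearMap.add_comp _ _ _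
  map_smul' _ _ := LinearMap.smul_comp _ _ _

end RelProjResolution

/-! #### The standard relative resolution -/

theorem isRelProjective_tensor (K : Type w) [AddCommGroup K] [Module k K] :
    IsRelProjective k R (R ⊗[k] K) := by
  intro Y Z _ _ _ _ _ _ _ _ g ⟨s, hs⟩ f
  refine ⟨AlgebraTensorModule.lift
    (LinearMap.toSpanSingleton R _ (s ∘ₗ (f.restrictScalars k) ∘ₗ TensorProduct.mk k R K 1)), ?_⟩
  ext x
  simp [hs]

/-- The action map `R ⊗ K → K`. -/
def actionMap (K : Type w) [AddCommGroup K] [Module k K] [Module R K] [IsScalarTower k R K] :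
    R ⊗[k] K →ₗ[R] K :=
  AlgebraTensorModule.lift (LinearMap.toSpanSingleton R _ LinearMap.id)

/-- A bundled `R`-module. -/
structure RelModule where
  carrier : Type w
  [addCommGroup : AddCommGroup carrier]
  [moduleBase : Module k carrier]
  [module : Module R carrier]
  [tower : IsScalarTower k R carrier]

attribute [instance] RelModule.addCommGroup RelModule.moduleBase
  RelModule.module RelModule.tower

variable (N : Type w) [AddCommGroup N] [Module k N] [Module R N] [IsScalarTower k R N]

/-- The iterated syzygies: `K₀ = ker (R ⊗ N → N)` and `Kₙ₊₁ = ker (R ⊗ Kₙ → Kₙ)`. -/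
def syzygy : ℕ → RelModule.{u, v, max v w} k R
  | 0 => ⟨LinearMap.ker (actionMap k R N)⟩
  | n + 1 => ⟨LinearMap.ker (actionMap k R (syzygy n).carrier)⟩

/-- The terms `R ⊗ N, R ⊗ K₀, R ⊗ K₁, …` of the standard resolution. -/
def standardTerm : ℕ → RelModule.{u, v, max v w} k R
  | 0 => ⟨R ⊗[k] N⟩
  | n + 1 => ⟨R ⊗[k] (syzygy k R N n).carrier⟩

/-- The inclusion of `Kₙ` in the `n`-th term. -/
def syzygyIncl : ∀ n, (syzygy k R N n).carrier →ₗ[R] (standardTerm k R N n).carrier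
  | 0 => (LinearMap.ker (actionMap k R N)).subtype
  | n + 1 => (LinearMap.ker (actionMap k R (syzygy k R N n).carrier)).subtype

theorem actionMap_tmul (K : Type w) [AddCommGroup K] [Module k K] [Module R K]
    [IsScalarTower k R K] (r : R) (y : K) : actionMap k R K (r ⊗ₜ y) = r • y := by
  simp [actionMap]

/-- The `k`-linear projection `y ↦ y - 1 ⊗ (action y)` of `R ⊗ K` onto the kernel of the action. -/
def kerProj (K : Type w) [AddCommGroup K] [Module k K] [Module R K] [IsScalarTower k R K] :
    R ⊗[k] K →ₗ[k] LinearMap.ker (actionMap k R K) where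
  toFun y := ⟨y - 1 ⊗ₜ actionMap k R K y, by simp [actionMap_tmul]⟩
  map_add' y z := by
    ext
    simp only [map_add, tmul_add, Submodule.coe_add]
    abel
  map_smul' c y := by
    ext
    have : actionMap k R K (c • y) = c • actionMap k R K y :=
      ((actionMap k R K).restrictScalars k).map_smul c y
    simp only [this, tmul_smul, RingHom.id_apply, Submodule.coe_smul_of_tower, smul_sub]

theorem kerProj_coe (K : Type w) [AddCommGroup K] [Module k K] [Module R K] [IsScalarTower k R K]
    (y : LinearMap.ker (actionMap k R K)) : kerProj k R K y = y := by
  ext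
  simp [kerProj]

theorem action_kerProj (K : Type w) [AddCommGroup K] [Module k K] [Module R K]
    [IsScalarTower k R K] (y : R ⊗[k] K) :
    (actionMap k R (LinearMap.ker (actionMap k R K)) (1 ⊗ₜ kerProj k R K y) : R ⊗[k] K) +
      1 ⊗ₜ actionMap k R K y = y := by
  rw [actionMap_tmul, one_smul]
  exact sub_add_cancel _ _

/-- The contracting homotopy of the standard resolution. -/
def standardHomotopy : ∀ n, (standardTerm k R N n).carrier →ₗ[k] (standardTerm k R N (n + 1)).carrier
  | 0 => TensorProduct.mk k R (syzygy k R N 0).carrier 1 ∘ₗ kerProj k R N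
  | n + 1 => TensorProduct.mk k R (syzygy k R N (n + 1)).carrier 1 ∘ₗ
      kerProj k R (syzygy k R N n).carrier

/-- The standard relative projective resolution, obtained by iterating `R ⊗ K → K`. -/
def standardResolution : RelProjResolution.{u, v, w, max v w} k R N where
  P n := (standardTerm k R N n).carrier
  relProjective n := match n with
    | 0 => isRelProjective_tensor k R N
    | n + 1 => isRelProjective_tensor k R (syzygy k R N n).carrier
  d n := syzygyIncl k R N n ∘ₗ actionMap k R (syzygy k R N n).carrier
  aug := actionMap k R N
  aug_comp_d := LinearMap.ext fun y =>
    (actionMap k R (syzygy k R N 0).carrier y).2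
  d_comp_d n := LinearMap.ext fun y => by
    have h : actionMap k R (syzygy k R N n).carrier (syzygyIncl k R N (n + 1)
      (actionMap k R (syzygy k R N (n + 1)).carrier y)) = 0 :=
        (actionMap k R (syzygy k R N (n + 1)).carrier y).2
    exact (congrArg (syzygyIncl k R N n) h).trans (map_zero _)
  contractible := by
    refine ⟨TensorProduct.mk k R N 1, standardHomotopy k R N, fun y => ?_, fun y => ?_, ?_⟩
    · exact (actionMap_tmul k R N 1 y).trans (one_smul R y)
    · exact action_kerProj k R N y
    · intro n y
      have h : standardHomotopy k R N n
          (syzygyIncl k R N n (actionMap k R (syzygy k R N n).carrier y)) =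
          (1 : R) ⊗ₜ[k] actionMap k R (syzygy k R N n).carrier y := by
        cases n with
        | zero => exact congrArg (TensorProduct.mk k R _ 1) (kerProj_coe k R N _)
        | succ n =>
          exact congrArg (TensorProduct.mk k R _ 1) (kerProj_coe k R (syzygy k R N n).carrier _)
      exact (congrArg _ h).trans (action_kerProj k R (syzygy k R N n).carrier y)

/-- `Extⁿ_{R,k}(N, Y)`: the Ext groups of the `R`-module `N`, relative to the family of the
`R`-linear epimorphisms which split as `k`-linear maps. -/
abbrev RelExt (Y : Type*) [AddCommGroup Y] [Module k Y] [Module R Y] [IsScalarTower k R Y]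
    (n : ℕ) : Type _ :=
  Cohomology ((standardResolution k R N).homD Y) n

end Relative

/-! ### The triangular matrix algebra -/

/-- The triangular matrices with rows `(a m)` and `(0 b)`. -/
@[ext]
structure Triangular (A M B : Type*) where
  a : A
  m : M
  b : B

namespace Triangular

set_option linter.unusedSectionVars false

variable {k A M B : Type*} [CommRing k] [Ring A] [Algebra k A] [Ring B] [Algebra k B]
  [AddCommGroup M] [Module k M]

instance : Zero (Triangular A M B) := ⟨⟨0, 0, 0⟩⟩
instance : Add (Triangular A M B) := ⟨fun x y => ⟨x.a + y.a, x.m + y.m, x.b + y.b⟩⟩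
instance : Neg (Triangular A M B) := ⟨fun x => ⟨-x.a, -x.m, -x.b⟩⟩
instance : One (Triangular A M B) := ⟨⟨1, 0, 1⟩⟩
instance : SMul k (Triangular A M B) := ⟨fun c x => ⟨c • x.a, c • x.m, c • x.b⟩⟩

@[simp] theorem zero_a : (0 : Triangular A M B).a = 0 := rfl
@[simp] theorem zero_m : (0 : Triangular A M B).m = 0 := rfl
@[simp] theorem zero_b : (0 : Triangular A M B).b = 0 := rfl
@[simp] theorem add_a (x y : Triangular A M B) : (x + y).a = x.a + y.a := rfl
@[simp] theorem add_m (x y : Triangular A M B) : (x + y).m = x.m + y.m := rfl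
@[simp] theorem add_b (x y : Triangular A M B) : (x + y).b = x.b + y.b := rfl
@[simp] theorem neg_a (x : Triangular A M B) : (-x).a = -x.a := rfl
@[simp] theorem neg_m (x : Triangular A M B) : (-x).m = -x.m := rfl
@[simp] theorem neg_b (x : Triangular A M B) : (-x).b = -x.b := rfl
@[simp] theorem one_a : (1 : Triangular A M B).a = 1 := rfl
@[simp] theorem one_m : (1 : Triangular A M B).m = 0 := rfl
@[simp] theorem one_b : (1 : Triangular A M B).b = 1 := rfl
@[simp] theorem smul_a (c : k) (x : Triangular A M B) : (c • x).a = c • x.a := rfl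
@[simp] theorem smul_m (c : k) (x : Triangular A M B) : (c • x).m = c • x.m := rfl
@[simp] theorem smul_b (c : k) (x : Triangular A M B) : (c • x).b = c • x.b := rfl

instance : AddCommGroup (Triangular A M B) where
  add_assoc x y z := by ext <;> simp [add_assoc]
  zero_add x := by ext <;> simp
  add_zero x := by ext <;> simp
  add_comm x y := by ext <;> simp [add_comm]
  neg_add_cancel x := by ext <;> simp
  nsmul := nsmulRec
  zsmul := zsmulRec

instance : Module k (Triangular A M B) where
  one_smul x := by ext <;> simp
  mul_smul c c' x := by ext <;> simp [mul_smul]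
  smul_zero c := by ext <;> simp
  smul_add c x y := by ext <;> simp
  add_smul c c' x := by ext <;> simp [add_smul]
  zero_smul x := by ext <;> simp

variable [Module A M] [Module Bᵐᵒᵖ M]

instance : Mul (Triangular A M B) :=
  ⟨fun x y => ⟨x.a * y.a, x.a • y.m + op y.b • x.m, x.b * y.b⟩⟩

@[simp] theorem mul_a (x y : Triangular A M B) : (x * y).a = x.a * y.a := rfl
@[simp] theorem mul_m (x y : Triangular A M B) : (x * y).m = x.a • y.m + op y.b • x.m := rfl
@[simp] theorem mul_b (x y : Triangular A M B) : (x * y).b = x.b * y.b := rfl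

variable [SMulCommClass A Bᵐᵒᵖ M]

instance : Ring (Triangular A M B) where
  __ := (inferInstance : AddCommGroup (Triangular A M B))
  mul_assoc x y z := by ext <;> simp [mul_assoc, mul_smul, add_assoc, smul_comm]
  one_mul x := by ext <;> simp
  mul_one x := by ext <;> simp
  left_distrib x y z := by
    ext <;> simp [mul_add, add_smul]
    abel
  right_distrib x y z := by
    ext <;> simp [add_mul, add_smul]
    abel
  zero_mul x := by ext <;> simp
  mul_zero x := by ext <;> simp

variable [IsScalarTower k A M] [IsScalarTower k Bᵐᵒᵖ M]

instance : Algebra k (Triangular A M B) :=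
  Algebra.ofModule
    (fun c x y => by ext <;> simp [smul_comm (op _) c])
    (fun c x y => by ext <;> simp [smul_comm _ c])

variable (A M B)

/-- The unit `1_A` of `A`, as an element of the triangular algebra. -/
def eA : Triangular A M B := ⟨1, 0, 0⟩

/-- The unit `1_B` of `B`, as an element of the triangular algebra. -/
def eB : Triangular A M B := ⟨0, 0, 1⟩

/-- The projection of the triangular algebra onto `B`. -/
def projB : Triangular A M B →+* B where
  toFun x := x.b
  map_one' := rfl
  map_mul' _ _ := rfl
  map_zero' := rfl
  map_add' _ _ := rfl

variable {A} in
/-- `A` as a (non-unital) subring of the triangular algebra. -/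
def inclA : A →ₙ+* Triangular A M B where
  toFun a := ⟨a, 0, 0⟩
  map_mul' _ _ := by ext <;> simp
  map_zero' := rfl
  map_add' _ _ := by ext <;> simp

variable {B} in
/-- `B` as a (non-unital) subring of the triangular algebra. -/
def inclB : B →ₙ+* Triangular A M B where
  toFun b := ⟨0, 0, b⟩
  map_mul' _ _ := by ext <;> simp
  map_zero' := rfl
  map_add' _ _ := by ext <;> simp

@[simp] theorem inclA_a (a : A) : (inclA M B a).a = a := rfl
@[simp] theorem inclA_m (a : A) : (inclA M B a).m = 0 := rfl
@[simp] theorem inclA_b (a : A) : (inclA M B a).b = 0 := rfl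
@[simp] theorem inclB_a (b : B) : (inclB A M b).a = 0 := rfl
@[simp] theorem inclB_m (b : B) : (inclB A M b).m = 0 := rfl
@[simp] theorem inclB_b (b : B) : (inclB A M b).b = b := rfl

end Triangular

section TensorModule

variable {k R S Y : Type*} [CommRing k] [Ring R] [Algebra k R] [Ring S] [Algebra k S]
  [AddCommGroup Y] [Module k Y] [Module R Y] [Module S Y] [IsScalarTower k R Y]
  [IsScalarTower k S Y] [SMulCommClass R S Y]

theorem isScalarTower_tensor :
    letI : Module (R ⊗[k] S) Y := TensorProduct.Algebra.module
    IsScalarTower k (R ⊗[k] S) Y := by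
  let _ : Module (R ⊗[k] S) Y := TensorProduct.Algebra.module
  refine ⟨fun c x y => ?_⟩
  change TensorProduct.Algebra.moduleAux (c • x) y = c • TensorProduct.Algebra.moduleAux x y
  simp

end TensorModule

open Triangular

section BE

/-- `B_E`: the algebra `B` as a left module over the triangular algebra `E` through the projection
`E → B`, and as a right module over `B` by multiplication. -/
def BE (_A _M B : Type*) : Type _ := B

set_option linter.unusedSectionVars false

variable {k A M B : Type*} [CommRing k] [Ring A] [Algebra k A] [Ring B] [Algebra k B]
  [AddCommGroup M] [Module k M] [Module A M] [Module Bᵐᵒᵖ M] [SMulCommClass A Bᵐᵒᵖ M]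
  [IsScalarTower k A M] [IsScalarTower k Bᵐᵒᵖ M]

instance : AddCommGroup (BE A M B) := inferInstanceAs (AddCommGroup B)

instance : Module k (BE A M B) := inferInstanceAs (Module k B)

instance : Module Bᵐᵒᵖ (BE A M B) := inferInstanceAs (Module Bᵐᵒᵖ B)

instance : Module (Triangular A M B) (BE A M B) :=
  (Module.compHom B (projB A M B) : Module (Triangular A M B) B)

theorem BE.smul_def (e : Triangular A M B) (y : B) :
    e • (show BE A M B from y) = (e.b * y : B) := rfl

theorem BE.op_smul_def (b y : B) :
    op b • (show BE A M B from y) = (y * b : B) := rfl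

instance : IsScalarTower k (Triangular A M B) (BE A M B) :=
  ⟨fun c e y => smul_mul_assoc (β := B) c e.b y⟩

instance : IsScalarTower k Bᵐᵒᵖ (BE A M B) := inferInstanceAs (IsScalarTower k Bᵐᵒᵖ B)

instance : SMulCommClass (Triangular A M B) Bᵐᵒᵖ (BE A M B) :=
  ⟨fun e b y => (mul_assoc (G := B) e.b y b.unop).symm⟩

instance : Module (Triangular A M B ⊗[k] Bᵐᵒᵖ) (BE A M B) := TensorProduct.Algebra.module

instance : IsScalarTower k (Triangular A M B ⊗[k] Bᵐᵒᵖ) (BE A M B) := isScalarTower_tensor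

end BE

/-! ### The modules `X 1_B` and `X_AA = 1_A X 1_A` -/

section Corners

set_option linter.unusedSectionVars false

variable (k A M B X : Type*) [CommRing k] [Ring A] [Algebra k A] [Ring B] [Algebra k B]
  [AddCommGroup M] [Module k M] [Module A M] [Module Bᵐᵒᵖ M] [SMulCommClass A Bᵐᵒᵖ M]
  [IsScalarTower k A M] [IsScalarTower k Bᵐᵒᵖ M]
  [AddCommGroup X] [Module k X] [Module (Triangular A M B) X] [Module (Triangular A M B)ᵐᵒᵖ X]
  [SMulCommClass (Triangular A M B) (Triangular A M B)ᵐᵒᵖ X]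
  [IsScalarTower k (Triangular A M B) X] [IsScalarTower k (Triangular A M B)ᵐᵒᵖ X]

/-- `X 1_B`, a left submodule of the `E`-bimodule `X`. -/
def X1B : Submodule (Triangular A M B) X where
  carrier := {x | ∃ y : X, op (eB A M B) • y = x}
  zero_mem' := ⟨0, smul_zero _⟩
  add_mem' := by
    rintro _ _ ⟨y, rfl⟩ ⟨z, rfl⟩
    exact ⟨y + z, smul_add _ _ _⟩
  smul_mem' := by
    rintro e _ ⟨y, rfl⟩
    exact ⟨e • y, (smul_comm _ _ _).symm⟩

/-- `X_AA = 1_A X 1_A`, a `k`-submodule of the `E`-bimodule `X`. -/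
def XAA : Submodule k X where
  carrier := {x | ∃ y : X, eA A M B • op (eA A M B) • y = x}
  zero_mem' := ⟨0, by simp⟩
  add_mem' := by
    rintro _ _ ⟨y, rfl⟩ ⟨z, rfl⟩
    exact ⟨y + z, by simp⟩
  smul_mem' := by
    rintro c _ ⟨y, rfl⟩
    exact ⟨c • y, by rw [smul_comm _ c, smul_comm _ c]⟩

variable {k A M B X}

theorem eB_smul_of_mem (x : X1B A M B X) : op (eB A M B) • (x : X) = x := by
  obtain ⟨_, y, rfl⟩ := x
  change op (eB A M B) • op (eB A M B) • y = op (eB A M B) • y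
  rw [smul_smul, ← op_mul]
  congr 2
  ext <;> simp [eB]

theorem eA_smul_of_mem (x : XAA k A M B X) : eA A M B • (x : X) = x := by
  obtain ⟨_, y, rfl⟩ := x
  change eA A M B • eA A M B • op (eA A M B) • y = eA A M B • op (eA A M B) • y
  rw [smul_smul]
  congr 1
  ext <;> simp [eA]

theorem op_eA_smul_of_mem (x : XAA k A M B X) : op (eA A M B) • (x : X) = x := by
  obtain ⟨_, y, rfl⟩ := x
  change op (eA A M B) • eA A M B • op (eA A M B) • y = eA A M B • op (eA A M B) • y
  rw [← smul_comm (eA A M B), smul_smul (op _), ← op_mul]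
  congr 3
  ext <;> simp [eA]

/-- The right action of `B` on `X 1_B`. -/
instance : Module Bᵐᵒᵖ (X1B A M B X) where
  smul b x := ⟨op (inclB A M b.unop) • (x : X), op (inclB A M b.unop) • (x : X), by
    rw [smul_smul, ← op_mul]
    congr 2
    ext <;> simp [eB]⟩
  one_smul x := Subtype.ext (eB_smul_of_mem x)
  mul_smul b c x := Subtype.ext <| by
    change op (inclB A M (b * c).unop) • (x : X) =
      op (inclB A M b.unop) • op (inclB A M c.unop) • (x : X)
    rw [unop_mul, map_mul, op_mul, mul_smul]
  smul_zero b := Subtype.ext (smul_zero _)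
  smul_add b x y := Subtype.ext (smul_add _ _ _)
  add_smul b c x := Subtype.ext <| by
    change op (inclB A M (b + c).unop) • (x : X) =
      op (inclB A M b.unop) • (x : X) + op (inclB A M c.unop) • (x : X)
    rw [unop_add, map_add, op_add, add_smul]
  zero_smul x := Subtype.ext <| by
    change op (inclB A M (0 : Bᵐᵒᵖ).unop) • (x : X) = 0
    rw [unop_zero, map_zero, op_zero, zero_smul]

theorem X1B.coe_op_smul (b : B) (x : X1B A M B X) :
    ((op b • x : X1B A M B X) : X) = op (inclB A M b) • (x : X) := rfl

instance : IsScalarTower k Bᵐᵒᵖ (X1B A M B X) :=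
  ⟨fun c b x => Subtype.ext <| by
    change op (inclB A M (c • b).unop) • (x : X) = c • op (inclB A M b.unop) • (x : X)
    rw [← smul_assoc, ← op_smul]
    congr 2
    ext <;> simp⟩

instance : SMulCommClass (Triangular A M B) Bᵐᵒᵖ (X1B A M B X) :=
  ⟨fun e b x => Subtype.ext (smul_comm e (op (inclB A M b.unop)) (x : X))⟩

instance : Module (Triangular A M B ⊗[k] Bᵐᵒᵖ) (X1B A M B X) := TensorProduct.Algebra.module

instance : IsScalarTower k (Triangular A M B ⊗[k] Bᵐᵒᵖ) (X1B A M B X) := isScalarTower_tensor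

/-- The left action of `A` on `X_AA`. -/
instance : Module A (XAA k A M B X) where
  smul a x := ⟨inclA M B a • (x : X), inclA M B a • (x : X), by
    rw [← smul_comm (inclA M B a), op_eA_smul_of_mem, smul_smul]
    congr 1
    ext <;> simp [eA]⟩
  one_smul x := Subtype.ext (eA_smul_of_mem x)
  mul_smul b c x := Subtype.ext <| by
    change inclA M B (b * c) • (x : X) = inclA M B b • inclA M B c • (x : X)
    rw [map_mul, mul_smul]
  smul_zero b := Subtype.ext (smul_zero _)
  smul_add b x y := Subtype.ext (smul_add _ _ _)
  add_smul b c x := Subtype.ext <| by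
    change inclA M B (b + c) • (x : X) = inclA M B b • (x : X) + inclA M B c • (x : X)
    rw [map_add, add_smul]
  zero_smul x := Subtype.ext <| by
    change inclA M B 0 • (x : X) = 0
    rw [map_zero, zero_smul]

/-- The right action of `A` on `X_AA`. -/
instance : Module Aᵐᵒᵖ (XAA k A M B X) where
  smul a x := ⟨op (inclA M B a.unop) • (x : X), op (inclA M B a.unop) • (x : X), by
    rw [smul_smul (op _), ← op_mul, smul_comm, eA_smul_of_mem]
    congr 2
    ext <;> simp [eA]⟩
  one_smul x := Subtype.ext (op_eA_smul_of_mem x)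
  mul_smul b c x := Subtype.ext <| by
    change op (inclA M B (b * c).unop) • (x : X) =
      op (inclA M B b.unop) • op (inclA M B c.unop) • (x : X)
    rw [unop_mul, map_mul, op_mul, mul_smul]
  smul_zero b := Subtype.ext (smul_zero _)
  smul_add b x y := Subtype.ext (smul_add _ _ _)
  add_smul b c x := Subtype.ext <| by
    change op (inclA M B (b + c).unop) • (x : X) =
      op (inclA M B b.unop) • (x : X) + op (inclA M B c.unop) • (x : X)
    rw [unop_add, map_add, op_add, add_smul]
  zero_smul x := Subtype.ext <| by
    change op (inclA M B (0 : Aᵐᵒᵖ).unop) • (x : X) = 0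
    rw [unop_zero, map_zero, op_zero, zero_smul]

theorem XAA.coe_smul (a : A) (x : XAA k A M B X) :
    ((a • x : XAA k A M B X) : X) = inclA M B a • (x : X) := rfl

theorem XAA.coe_op_smul (a : A) (x : XAA k A M B X) :
    ((op a • x : XAA k A M B X) : X) = op (inclA M B a) • (x : X) := rfl

instance : SMulCommClass A Aᵐᵒᵖ (XAA k A M B X) :=
  ⟨fun a b x => Subtype.ext (smul_comm (inclA M B a) (op (inclA M B b.unop)) (x : X))⟩

instance : IsScalarTower k A (XAA k A M B X) :=
  ⟨fun c a x => Subtype.ext <| by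
    change inclA M B (c • a) • (x : X) = c • inclA M B a • (x : X)
    rw [← smul_assoc]
    congr 1
    ext <;> simp⟩

instance : IsScalarTower k Aᵐᵒᵖ (XAA k A M B X) :=
  ⟨fun c a x => Subtype.ext <| by
    change op (inclA M B (c • a).unop) • (x : X) = c • op (inclA M B a.unop) • (x : X)
    rw [← smul_assoc, ← op_smul]
    congr 2
    ext <;> simp⟩

end Corners

/-! ### Cochain complexes of modules -/

section Complexes

variable {k : Type*} [CommRing k]
  {C : ℕ → Type*} [∀ n, AddCommGroup (C n)] [∀ n, Module k (C n)]
  {D : ℕ → Type*} [∀ n, AddCommGroup (D n)] [∀ n, Module k (D n)]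

/-! The lower left entry of `E` vanishes, so `1_B E = B` and `E 1_A = A`. Hence `X 1_B` is a
sub-bimodule of `X`, on which `E` acts on the right through `E → B`. The quotient is `X 1_A`, with
`E` acting on the right through `E → A`, and `X = X 1_B ⊕ X 1_A` splits this extension `k`-linearly.
Hochschild cochains are `k`-multilinear, so they turn it into a short exact sequence of complexes,
and `exists_long_exact_sequence` applies. The middle term is `H(E, X)`; it remains to identify `H(E,
X 1_B)` with relative Ext (`nonempty_relExt_linearEquiv`) and `H(E, X 1_A)` with `H(A, X_AA)`
(`nonempty_H_inflation_linearEquiv`, `nonempty_H_corner_X1A_linearEquiv`).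

Both identifications are proved by dimension shifting. For `R = E ⊗ Cᵒᵖ`, with `C = B` or `C = A`,
an `R`-module `Y` embeds in the coinduced module `Hom_k(R, Y)`, and evaluation at `1` splits the
embedding over `k`. Coinduced modules have no higher cohomology in any of the theories compared:
`isAcyclicPos_of_isCoinducedRetraction` for Hochschild cochains, `isAcyclicPos_homD_coinduced` for
relative Ext, `isAcyclicPos_corner` for the corner. So, by
`IsQuasiIsoAt.succ_of_isShortExactComplex`, a natural cochain map that is an isomorphism on
cohomology in degree 0 is one in every degree.

For Ext, the cochain map sends `f : Pₙ → Y` to `f ∘ θₙ`, where the universal cochains `θₙ` with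
values in `Pₙ` are built from the contracting homotopy. In degree 0 it is `φ ↦ φ(1)`, and `B_E` is
generated by `1` with the relations `e · 1 = 1 · e.b`. For the corner, the cochain map restricts the
arguments to `A` and cuts the values down by `1_A` on both sides. -/

theorem d_eq_zero_of_mem_coboundaries {d : ∀ n, C n →ₗ[k] C (n + 1)}
    (hd : ∀ n c, d (n + 1) (d n c) = 0) {n : ℕ} {c : C n} (hc : c ∈ coboundaries d n) :
    d n c = 0 := by
  cases n with
  | zero => rw [show c = 0 from hc, map_zero]
  | succ n =>
    obtain ⟨b, rfl⟩ := hc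
    exact hd n b

theorem map_mem_coboundaries {dC : ∀ n, C n →ₗ[k] C (n + 1)} {dD : ∀ n, D n →ₗ[k] D (n + 1)}
    {g : ∀ n, C n →ₗ[k] D n} (hg : ∀ n c, dD n (g n c) = g (n + 1) (dC n c)) {n : ℕ} {c : C n}
    (hc : c ∈ coboundaries dC n) : g n c ∈ coboundaries dD n := by
  cases n with
  | zero => rw [show c = 0 from hc, map_zero]; exact zero_mem _
  | succ n =>
    obtain ⟨b, rfl⟩ := hc
    exact ⟨g n b, hg n b⟩

theorem exists_mem_coboundaries_lift {dC : ∀ n, C n →ₗ[k] C (n + 1)}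
    {dD : ∀ n, D n →ₗ[k] D (n + 1)} {g : ∀ n, C n →ₗ[k] D n}
    (hg : ∀ n c, dD n (g n c) = g (n + 1) (dC n c)) (hs : ∀ n, Function.Surjective (g n)) {n : ℕ}
    {c : D n} (hc : c ∈ coboundaries dD n) : ∃ b ∈ coboundaries dC n, g n b = c := by
  cases n with
  | zero => exact ⟨0, zero_mem _, by rw [show c = 0 from hc, map_zero]⟩
  | succ n =>
    obtain ⟨b, rfl⟩ := hc
    obtain ⟨a, rfl⟩ := hs n b
    exact ⟨dC n a, ⟨a, rfl⟩, (hg n a).symm⟩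

/-- The map induced on cohomology by a cochain map. -/
def cohomologyMap {dC : ∀ n, C n →ₗ[k] C (n + 1)} {dD : ∀ n, D n →ₗ[k] D (n + 1)}
    (g : ∀ n, C n →ₗ[k] D n) (hg : ∀ n c, dD n (g n c) = g (n + 1) (dC n c)) (n : ℕ) :
    Cohomology dC n →ₗ[k] Cohomology dD n :=
  Submodule.mapQ _ _
    ((g n).restrict (p := LinearMap.ker (dC n)) (q := LinearMap.ker (dD n)) fun c hc => by
      rw [LinearMap.mem_ker] at hc ⊢
      rw [hg, hc, map_zero])
    fun c hc => map_mem_coboundaries (dC := dC) hg (c := c.1) hc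

/-- The class of a cocycle. -/
def Cohomology.mk {d : ∀ n, C n →ₗ[k] C (n + 1)} {n : ℕ} (c : C n) (hc : d n c = 0) :
    Cohomology d n :=
  Submodule.Quotient.mk ⟨c, hc⟩

theorem Cohomology.exists_mk {d : ∀ n, C n →ₗ[k] C (n + 1)} {n : ℕ} (x : Cohomology d n) :
    ∃ (c : C n) (hc : d n c = 0), Cohomology.mk c hc = x := by
  obtain ⟨⟨c, hc⟩, rfl⟩ := Submodule.Quotient.mk_surjective _ x
  exact ⟨c, hc, rfl⟩

theorem Cohomology.mk_eq_mk {d : ∀ n, C n →ₗ[k] C (n + 1)} {n : ℕ} {c c' : C n} {hc : d n c = 0}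
    {hc' : d n c' = 0} :
    (Cohomology.mk c hc : Cohomology d n) = Cohomology.mk c' hc' ↔
      c - c' ∈ coboundaries d n :=
  Submodule.Quotient.eq _

theorem Cohomology.mk_eq_zero {d : ∀ n, C n →ₗ[k] C (n + 1)} {n : ℕ} {c : C n} {hc : d n c = 0} :
    (Cohomology.mk c hc : Cohomology d n) = 0 ↔ c ∈ coboundaries d n :=
  Submodule.Quotient.mk_eq_zero _

theorem cohomologyMap_mk {dC : ∀ n, C n →ₗ[k] C (n + 1)} {dD : ∀ n, D n →ₗ[k] D (n + 1)}
    (g : ∀ n, C n →ₗ[k] D n) (hg : ∀ n c, dD n (g n c) = g (n + 1) (dC n c)) {n : ℕ} (c : C n)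
    (hc : dC n c = 0) :
    cohomologyMap g hg n (Cohomology.mk c hc) =
      Cohomology.mk (g n c) (by rw [hg, hc, map_zero]) := rfl

/-- A cochain map induces a bijection on cohomology in degree `n`, expressed on cocycles. -/
structure IsQuasiIsoAt (dC : ∀ n, C n →ₗ[k] C (n + 1)) (dD : ∀ n, D n →ₗ[k] D (n + 1))
    (g : ∀ n, C n →ₗ[k] D n) (n : ℕ) : Prop where
  injective : ∀ c, dC n c = 0 → g n c ∈ coboundaries dD n → c ∈ coboundaries dC n
  surjective : ∀ b, dD n b = 0 → ∃ c, dC n c = 0 ∧ b - g n c ∈ coboundaries dD n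

theorem IsQuasiIsoAt.nonempty_linearEquiv {dC : ∀ n, C n →ₗ[k] C (n + 1)}
    {dD : ∀ n, D n →ₗ[k] D (n + 1)} {g : ∀ n, C n →ₗ[k] D n}
    (hg : ∀ n c, dD n (g n c) = g (n + 1) (dC n c)) {n : ℕ} (h : IsQuasiIsoAt dC dD g n) :
    Nonempty (Cohomology dC n ≃ₗ[k] Cohomology dD n) := by
  refine ⟨LinearEquiv.ofBijective (cohomologyMap g hg n) ⟨?_, ?_⟩⟩
  · rw [injective_iff_map_eq_zero]
    intro x hx
    obtain ⟨c, hc, rfl⟩ := x.exists_mk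
    rw [cohomologyMap_mk, Cohomology.mk_eq_zero] at hx
    exact Cohomology.mk_eq_zero.2 (h.injective c hc hx)
  · intro y
    obtain ⟨b, hb, rfl⟩ := y.exists_mk
    obtain ⟨c, hc, hbc⟩ := h.surjective b hb
    refine ⟨Cohomology.mk c hc, ?_⟩
    rw [cohomologyMap_mk, eq_comm, Cohomology.mk_eq_mk]
    exact hbc

theorem IsQuasiIsoAt.of_bijective {dC : ∀ n, C n →ₗ[k] C (n + 1)}
    {dD : ∀ n, D n →ₗ[k] D (n + 1)} {g : ∀ n, C n →ₗ[k] D n}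
    (hg : ∀ n c, dD n (g n c) = g (n + 1) (dC n c)) (hb : ∀ n, Function.Bijective (g n)) (n : ℕ) :
    IsQuasiIsoAt dC dD g n where
  injective c _ h := by
    obtain ⟨b, hb', e⟩ := exists_mem_coboundaries_lift hg (fun n => (hb n).2) h
    rwa [← (hb n).1 e]
  surjective b h := by
    obtain ⟨c, rfl⟩ := (hb n).2 b
    refine ⟨c, (hb _).1 ?_, by rw [sub_self]; exact zero_mem _⟩
    rw [← hg, h, map_zero]

/-- The complex has no cohomology in positive degrees. -/
def IsAcyclicPos (d : ∀ n, C n →ₗ[k] C (n + 1)) : Prop :=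
  ∀ n c, d (n + 1) c = 0 → ∃ b, d n b = c

/-- `0 → C' → C → C'' → 0` is a short exact sequence of complexes. -/
structure IsShortExactComplex {C' C C'' : ℕ → Type*}
    [∀ n, AddCommGroup (C' n)] [∀ n, Module k (C' n)]
    [∀ n, AddCommGroup (C n)] [∀ n, Module k (C n)]
    [∀ n, AddCommGroup (C'' n)] [∀ n, Module k (C'' n)]
    (d' : ∀ n, C' n →ₗ[k] C' (n + 1)) (d : ∀ n, C n →ₗ[k] C (n + 1))
    (d'' : ∀ n, C'' n →ₗ[k] C'' (n + 1))
    (ι : ∀ n, C' n →ₗ[k] C n) (π : ∀ n, C n →ₗ[k] C'' n) : Prop where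
  comm_left : ∀ n c, d n (ι n c) = ι (n + 1) (d' n c)
  comm_right : ∀ n c, d'' n (π n c) = π (n + 1) (d n c)
  injective : ∀ n, Function.Injective (ι n)
  exact : ∀ n, Function.Exact (ι n) (π n)
  surjective : ∀ n, Function.Surjective (π n)

/-- Dimension shifting: a map between two short exact sequences of complexes whose middle terms
are acyclic in positive degrees. -/
theorem IsQuasiIsoAt.succ_of_isShortExactComplex
    {C' C C'' D' D D'' : ℕ → Type*}
    [∀ n, AddCommGroup (C' n)] [∀ n, Module k (C' n)]
    [∀ n, AddCommGroup (C n)] [∀ n, Module k (C n)]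
    [∀ n, AddCommGroup (C'' n)] [∀ n, Module k (C'' n)]
    [∀ n, AddCommGroup (D' n)] [∀ n, Module k (D' n)]
    [∀ n, AddCommGroup (D n)] [∀ n, Module k (D n)]
    [∀ n, AddCommGroup (D'' n)] [∀ n, Module k (D'' n)]
    {dC' : ∀ n, C' n →ₗ[k] C' (n + 1)} {dC : ∀ n, C n →ₗ[k] C (n + 1)}
    {dC'' : ∀ n, C'' n →ₗ[k] C'' (n + 1)}
    {dD' : ∀ n, D' n →ₗ[k] D' (n + 1)} {dD : ∀ n, D n →ₗ[k] D (n + 1)}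
    {dD'' : ∀ n, D'' n →ₗ[k] D'' (n + 1)}
    {ιC : ∀ n, C' n →ₗ[k] C n} {πC : ∀ n, C n →ₗ[k] C'' n}
    {ιD : ∀ n, D' n →ₗ[k] D n} {πD : ∀ n, D n →ₗ[k] D'' n}
    {η' : ∀ n, C' n →ₗ[k] D' n} {η : ∀ n, C n →ₗ[k] D n} {η'' : ∀ n, C'' n →ₗ[k] D'' n}
    (hC : IsShortExactComplex dC' dC dC'' ιC πC) (hD : IsShortExactComplex dD' dD dD'' ιD πD)
    (hη : ∀ n c, dD n (η n c) = η (n + 1) (dC n c))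
    (hι : ∀ n c, ιD n (η' n c) = η n (ιC n c)) (hπ : ∀ n c, πD n (η n c) = η'' n (πC n c))
    (hdC : ∀ n c, dC (n + 1) (dC n c) = 0) (hdD : ∀ n c, dD (n + 1) (dD n c) = 0)
    (aC : IsAcyclicPos dC) (aD : IsAcyclicPos dD) (h0 : IsQuasiIsoAt dC dD η 0)
    (n : ℕ) (h : IsQuasiIsoAt dC'' dD'' η'' n) : IsQuasiIsoAt dC' dD' η' (n + 1) where
  injective φ hφ hηφ := by
    obtain ⟨g, hg⟩ := hηφ
    obtain ⟨ψ, hψ⟩ := aC n (ιC _ φ) (by rw [hC.comm_left, hφ, map_zero])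
    have hz : dD n (ιD n g - η n ψ) = 0 := by
      rw [map_sub, hD.comm_left, hη, hg, hψ, hι, sub_self]
    -- The cocycle `ιD g - η ψ` comes from a cocycle `ω` up to a coboundary. In positive degrees
    -- acyclicity makes it a coboundary, so `ω = 0` will do; in degree 0 acyclicity says nothing and
    -- `h0` supplies `ω`.
    have hs : ∃ ω, dC n ω = 0 ∧ ιD n g - η n ψ - η n ω ∈ coboundaries dD n := by
      cases n with
      | zero => exact h0.surjective _ hz
      | succ n =>
        obtain ⟨b, hb⟩ := aD n _ hz
        exact ⟨0, map_zero _, b, by rw [hb, map_zero, sub_zero]⟩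
    obtain ⟨ω, hω, hω'⟩ := hs
    have h1 : πC n (ψ + ω) ∈ coboundaries dC'' n := by
      refine h.injective _ ?_ ?_
      · rw [hC.comm_right, map_add, hψ, hω, add_zero]
        exact (hC.exact _).apply_apply_eq_zero φ
      · have := neg_mem (map_mem_coboundaries hD.comm_right hω')
        rw [map_sub, map_sub, (hD.exact n).apply_apply_eq_zero, hπ, hπ] at this
        simpa [add_comm] using this
    -- The element `ψ + ω - χ` still has coboundary `ιC φ`, and now it lies in the image of `ιC`;
    -- its preimage bounds `φ`.
    obtain ⟨χ, hχ, hχ'⟩ := exists_mem_coboundaries_lift hC.comm_right hC.surjective h1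
    obtain ⟨b, hb⟩ := (hC.exact n (ψ + ω - χ)).1 (by rw [map_sub, hχ', sub_self])
    refine ⟨b, hC.injective _ ?_⟩
    rw [← hC.comm_left, hb, map_sub, map_add, hψ, hω,
      d_eq_zero_of_mem_coboundaries hdC hχ, add_zero, sub_zero]
  surjective g hg := by
    -- The class of `g` is the connecting image of the class of `πD b`. That class comes from a
    -- cocycle `πC φ`, whose connecting image `φ'` is the required preimage.
    obtain ⟨b, hb⟩ := aD n (ιD _ g) (by rw [hD.comm_left, hg, map_zero])
    obtain ⟨φ'', hφ'', hbφ⟩ := h.surjective (πD n b) (by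
      rw [hD.comm_right, hb]; exact (hD.exact _).apply_apply_eq_zero g)
    obtain ⟨φ, rfl⟩ := hC.surjective n φ''
    obtain ⟨c, hc, hc'⟩ := exists_mem_coboundaries_lift hD.comm_right hD.surjective hbφ
    obtain ⟨b', hb'⟩ := (hD.exact n (b - η n φ - c)).1 (by
      rw [map_sub, map_sub, hc', hπ, sub_self])
    obtain ⟨φ', hφ'⟩ := (hC.exact (n + 1) (dC n φ)).1 (by rw [← hC.comm_right, hφ''])
    refine ⟨φ', hC.injective _ ?_, b', hD.injective _ ?_⟩
    · rw [← hC.comm_left, hφ', hdC, map_zero]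
    · rw [← hD.comm_left, hb', map_sub, map_sub, hb, hη, d_eq_zero_of_mem_coboundaries hdD hc,
        sub_zero, map_sub, hι, hφ']

/-- The long exact cohomology sequence of a short exact sequence of complexes that splits in each
degree. -/
theorem exists_long_exact_sequence {C' C C'' : ℕ → Type*}
    [∀ n, AddCommGroup (C' n)] [∀ n, Module k (C' n)]
    [∀ n, AddCommGroup (C n)] [∀ n, Module k (C n)]
    [∀ n, AddCommGroup (C'' n)] [∀ n, Module k (C'' n)]
    {d' : ∀ n, C' n →ₗ[k] C' (n + 1)} {d : ∀ n, C n →ₗ[k] C (n + 1)}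
    {d'' : ∀ n, C'' n →ₗ[k] C'' (n + 1)}
    {ι : ∀ n, C' n →ₗ[k] C n} {π : ∀ n, C n →ₗ[k] C'' n}
    (h : IsShortExactComplex d' d d'' ι π) (hd : ∀ n c, d (n + 1) (d n c) = 0)
    (ρ : ∀ n, C n →ₗ[k] C' n) (σ : ∀ n, C'' n →ₗ[k] C n)
    (hρ : ∀ n c, ρ n (ι n c) = c) (hσ : ∀ n c, π n (σ n c) = c) :
    ∃ (i : ∀ n, Cohomology d' n →ₗ[k] Cohomology d n)
      (j : ∀ n, Cohomology d n →ₗ[k] Cohomology d'' n)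
      (δ : ∀ n, Cohomology d'' n →ₗ[k] Cohomology d' (n + 1)),
      Function.Injective (i 0) ∧
      ∀ n, Function.Exact (i n) (j n) ∧ Function.Exact (j n) (δ n) ∧
        Function.Exact (δ n) (i (n + 1)) := by
  have lift : ∀ n c, π n c = 0 → ι n (ρ n c) = c := by
    intro n c hc
    obtain ⟨b, rfl⟩ := (h.exact n c).1 hc
    rw [hρ]
  have hpi : ∀ n c, π n (ι n c) = 0 := fun n => (h.exact n).apply_apply_eq_zero
  have key : ∀ n c, d'' n c = 0 → ι (n + 1) (ρ (n + 1) (d n (σ n c))) = d n (σ n c) :=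
    fun n c hc => lift _ _ (by rw [← h.comm_right, hσ, hc])
  have hδ : ∀ n c, d'' n c = 0 → d' (n + 1) (ρ (n + 1) (d n (σ n c))) = 0 := fun n c hc =>
    h.injective _ (by rw [← h.comm_left, key n c hc, hd, map_zero])
  -- Any lift `c` of `π c` may replace the chosen lift `σ (π c)`: the two differ by an element of
  -- `C'`, which changes the connecting cocycle by a coboundary.
  have hcob : ∀ n (c : C n),
      ρ (n + 1) (d n (σ n (π n c))) - ρ (n + 1) (d n c) ∈ coboundaries d' (n + 1) := by
    intro n c
    refine ⟨ρ n (σ n (π n c) - c), h.injective _ ?_⟩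
    rw [← h.comm_left, lift _ _ (by rw [map_sub, hσ, sub_self]), ← map_sub, lift, map_sub]
    rw [← map_sub, ← h.comm_right, map_sub, hσ, sub_self, map_zero]
  let δ₀ : ∀ n, LinearMap.ker (d'' n) →ₗ[k] LinearMap.ker (d' (n + 1)) := fun n =>
    LinearMap.restrict (ρ (n + 1) ∘ₗ d n ∘ₗ σ n) fun c hc => hδ n c hc
  let δ : ∀ n, Cohomology d'' n →ₗ[k] Cohomology d' (n + 1) := fun n =>
    Submodule.mapQ _ _ (δ₀ n) fun c hc => by
      -- A coboundary lifts to a coboundary `b`. Computed from this lift, the connecting cocycle is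
      -- zero because `d b = 0`.
      obtain ⟨b, hb, hbc⟩ := exists_mem_coboundaries_lift h.comm_right h.surjective hc
      have := hcob n b
      rw [d_eq_zero_of_mem_coboundaries hd hb, map_zero, sub_zero, hbc] at this
      exact this
  have δ_mk : ∀ n c (hc : d'' n c = 0), δ n (Cohomology.mk c hc) =
      Cohomology.mk (ρ (n + 1) (d n (σ n c))) (hδ n c hc) := fun _ _ _ => rfl
  refine ⟨cohomologyMap ι h.comm_left, cohomologyMap π h.comm_right, δ, ?_, fun n => ⟨?_, ?_, ?_⟩⟩
  · rw [injective_iff_map_eq_zero]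
    intro x hx
    obtain ⟨c, hc, rfl⟩ := x.exists_mk
    rw [cohomologyMap_mk, Cohomology.mk_eq_zero] at hx
    rw [Cohomology.mk_eq_zero]
    exact h.injective 0 ((show ι 0 c = 0 from hx).trans (map_zero _).symm)
  · intro x
    obtain ⟨c, hc, rfl⟩ := x.exists_mk
    rw [cohomologyMap_mk, Cohomology.mk_eq_zero]
    constructor
    · intro hx
      obtain ⟨b, hb, hbc⟩ := exists_mem_coboundaries_lift h.comm_right h.surjective hx
      have hl := lift n (c - b) (by rw [map_sub, hbc, sub_self])
      refine ⟨Cohomology.mk (ρ n (c - b)) (h.injective _ ?_), ?_⟩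
      · rw [← h.comm_left, hl, map_sub, hc, d_eq_zero_of_mem_coboundaries hd hb, sub_zero, map_zero]
      · rw [cohomologyMap_mk, Cohomology.mk_eq_mk, hl, sub_sub_cancel_left]
        exact neg_mem hb
    · rintro ⟨y, hy⟩
      obtain ⟨b, hb, rfl⟩ := y.exists_mk
      rw [cohomologyMap_mk, Cohomology.mk_eq_mk] at hy
      have := neg_mem (map_mem_coboundaries h.comm_right hy)
      rw [map_sub, hpi, zero_sub, neg_neg] at this
      exact this
  · intro x
    obtain ⟨c, hc, rfl⟩ := x.exists_mk
    rw [δ_mk, Cohomology.mk_eq_zero]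
    constructor
    · rintro ⟨b, hb⟩
      refine ⟨Cohomology.mk (σ n c - ι n b) ?_, ?_⟩
      · rw [map_sub, h.comm_left, hb, key n c hc, sub_self]
      · rw [cohomologyMap_mk, Cohomology.mk_eq_mk, map_sub, hσ, hpi, sub_zero, sub_self]
        exact zero_mem _
    · rintro ⟨y, hy⟩
      obtain ⟨b, hb, rfl⟩ := y.exists_mk
      rw [cohomologyMap_mk, Cohomology.mk_eq_mk] at hy
      obtain ⟨a, ha, hab⟩ := exists_mem_coboundaries_lift h.comm_right h.surjective hy
      have hc' : c = π n (b - a) := by rw [map_sub, hab, sub_sub_cancel]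
      refine ⟨ρ n (σ n c - (b - a)), h.injective _ ?_⟩
      rw [← h.comm_left, lift _ _ (by rw [map_sub, hσ, hc', sub_self]), key n c hc, map_sub,
        map_sub, hb, d_eq_zero_of_mem_coboundaries hd ha, sub_zero, sub_zero]
  · intro x
    obtain ⟨c, hc, rfl⟩ := x.exists_mk
    rw [cohomologyMap_mk, Cohomology.mk_eq_zero]
    constructor
    · rintro ⟨b, hb⟩
      have hz : d'' n (π n b) = 0 := by rw [h.comm_right, hb, hpi]
      refine ⟨Cohomology.mk (π n b) hz, ?_⟩
      rw [δ_mk, Cohomology.mk_eq_mk]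
      refine ⟨ρ n (σ n (π n b) - b), h.injective _ ?_⟩
      rw [← h.comm_left, lift _ _ (by rw [map_sub, hσ, sub_self]), map_sub, map_sub, hb,
        key n _ hz]
    · rintro ⟨y, hy⟩
      obtain ⟨b, hb, rfl⟩ := y.exists_mk
      rw [δ_mk, Cohomology.mk_eq_mk] at hy
      obtain ⟨a, ha⟩ := hy
      refine ⟨σ n b - ι n a, ?_⟩
      rw [map_sub, h.comm_left, ha, map_sub, key n b hb, sub_sub_cancel]

end Complexes

/-! ### Functoriality and vanishing of Hochschild cohomology -/

namespace Hochschild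

section CochainMap

variable {k A E X Y : Type*} [CommRing k] [Ring A] [Algebra k A] [Ring E] [Algebra k E]
  [AddCommGroup X] [Module k X] [AddCommGroup Y] [Module k Y]

/-- `f ↦ φ ∘ f ∘ (α × ⋯ × α)`. -/
def cochainMap (α : A →ₗ[k] E) (φ : X →ₗ[k] Y) (n : ℕ) :
    MultilinearMap k (fun _ : Fin n => E) X →ₗ[k] MultilinearMap k (fun _ : Fin n => A) Y where
  toFun f := φ.compMultilinearMap (f.compLinearMap fun _ => α)
  map_add' f g := by ext; simp
  map_smul' c f := by ext; simp

@[simp]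
theorem cochainMap_apply (α : A →ₗ[k] E) (φ : X →ₗ[k] Y) (n : ℕ)
    (f : MultilinearMap k (fun _ : Fin n => E) X) (g : Fin n → A) :
    cochainMap α φ n f g = φ (f fun i => α (g i)) := rfl

theorem comp_contractNth {A E : Type*} [Mul A] [Mul E] {α : A → E}
    (hα : ∀ a b, α (a * b) = α a * α b) {n : ℕ} (j : Fin (n + 1)) (g : Fin (n + 1) → A) :
    (fun i => α (Fin.contractNth j (· * ·) g i)) =
      Fin.contractNth j (· * ·) fun i => α (g i) := by
  funext q
  simp only [Fin.contractNth]
  split_ifs <;> simp [hα]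

/-- Post-composition with a map of coefficients. -/
abbrev coeffMap (A : Type*) [Ring A] [Algebra k A] {X Y : Type*} [AddCommGroup X] [Module k X]
    [AddCommGroup Y] [Module k Y] (φ : X →ₗ[k] Y) (n : ℕ) :
    MultilinearMap k (fun _ : Fin n => A) X →ₗ[k] MultilinearMap k (fun _ : Fin n => A) Y :=
  cochainMap LinearMap.id φ n

theorem coeffMap_coeffMap {φ : X →ₗ[k] Y} {ψ : Y →ₗ[k] X} (h : ∀ x, ψ (φ x) = x) (n : ℕ)
    (f : MultilinearMap k (fun _ : Fin n => A) X) : coeffMap A ψ n (coeffMap A φ n f) = f := by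
  ext g
  simp [h]

end CochainMap

section Functoriality

variable {k A E X Y : Type*} [CommRing k] [Ring A] [Algebra k A] [Ring E] [Algebra k E]
  [AddCommGroup X] [Module k X] [Module E X] [Module Eᵐᵒᵖ X] [SMulCommClass E Eᵐᵒᵖ X]
  [IsScalarTower k E X] [IsScalarTower k Eᵐᵒᵖ X]
  [AddCommGroup Y] [Module k Y] [Module A Y] [Module Aᵐᵒᵖ Y] [SMulCommClass A Aᵐᵒᵖ Y]
  [IsScalarTower k A Y] [IsScalarTower k Aᵐᵒᵖ Y]

theorem d_d_apply (n : ℕ) (f : MultilinearMap k (fun _ : Fin n => A) Y) :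
    d k A Y (n + 1) (d k A Y n f) = 0 :=
  LinearMap.congr_fun (d_comp_d n) f

/-- No face of the Hochschild coboundary involves the unit, so `α` need only be multiplicative. This
admits the inclusion of `A` in `E`, which sends `1` to the idempotent `1_A`. -/
theorem d_cochainMap {α : A →ₗ[k] E} {φ : X →ₗ[k] Y} (hα : ∀ a b, α (a * b) = α a * α b)
    (hl : ∀ a x, φ (α a • x) = a • φ x) (hr : ∀ a x, φ (op (α a) • x) = op a • φ x) (n : ℕ)
    (f : MultilinearMap k (fun _ : Fin n => E) X) :
    d k A Y n (cochainMap α φ n f) = cochainMap α φ (n + 1) (d k E X n f) := by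
  ext g
  simp only [cochainMap_apply, d_apply, comp_contractNth hα, map_add, map_sum, map_smul, hl, hr]
  rfl

/-- Cochains are arbitrary `k`-multilinear maps, so a `k`-linear splitting of the coefficients
suffices; `ρ` and `σ` need not respect the actions of `A`. -/
theorem isShortExactComplex_coeffMap {X' X X'' : Type*}
    [AddCommGroup X'] [Module k X'] [Module A X'] [Module Aᵐᵒᵖ X'] [SMulCommClass A Aᵐᵒᵖ X']
    [IsScalarTower k A X'] [IsScalarTower k Aᵐᵒᵖ X']
    [AddCommGroup X] [Module k X] [Module A X] [Module Aᵐᵒᵖ X] [SMulCommClass A Aᵐᵒᵖ X]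
    [IsScalarTower k A X] [IsScalarTower k Aᵐᵒᵖ X]
    [AddCommGroup X''] [Module k X''] [Module A X''] [Module Aᵐᵒᵖ X''] [SMulCommClass A Aᵐᵒᵖ X'']
    [IsScalarTower k A X''] [IsScalarTower k Aᵐᵒᵖ X'']
    {ι : X' →ₗ[k] X} {π : X →ₗ[k] X''} {ρ : X →ₗ[k] X'} {σ : X'' →ₗ[k] X}
    (hιl : ∀ (a : A) x, ι (a • x) = a • ι x) (hιr : ∀ (a : A) x, ι (op a • x) = op a • ι x)
    (hπl : ∀ (a : A) x, π (a • x) = a • π x) (hπr : ∀ (a : A) x, π (op a • x) = op a • π x)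
    (hρ : ∀ x, ρ (ι x) = x) (hσ : ∀ x, π (σ x) = x) (hπι : ∀ x, π (ι x) = 0)
    (hex : ∀ x, π x = 0 → ι (ρ x) = x) :
    IsShortExactComplex (d k A X') (d k A X) (d k A X'') (coeffMap A ι) (coeffMap A π) where
  comm_left := d_cochainMap (fun _ _ => rfl) hιl hιr
  comm_right := d_cochainMap (fun _ _ => rfl) hπl hπr
  injective n := Function.LeftInverse.injective (coeffMap_coeffMap hρ n)
  surjective n := Function.RightInverse.surjective (coeffMap_coeffMap hσ n)
  exact n f := by
    constructor
    · intro hf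
      refine ⟨coeffMap A ρ n f, ?_⟩
      ext g
      exact hex _ (congrArg (fun F => F g) hf)
    · rintro ⟨g, rfl⟩
      ext
      simp [hπι]

end Functoriality

section Acyclic

/-- `a ↦ f (a, x₁, …, xₙ)`. -/
def firstVariable {k A I : Type*} [CommRing k] [Ring A] [Algebra k A] [AddCommGroup I]
    [Module k I] {n : ℕ} (f : MultilinearMap k (fun _ : Fin (n + 1) => A) I) (x : Fin n → A) :
    A →ₗ[k] I where
  toFun a := f (Fin.cons a x)
  map_add' a b := congrArg (fun F => F x) (f.curryLeft.map_add a b)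
  map_smul' c a := congrArg (fun F => F x) (f.curryLeft.map_smul c a)

/-- `(x₁, …, xₙ) ↦ κ (a ↦ f (a, x₁, …, xₙ))`. -/
def contraction {k A I : Type*} [CommRing k] [Ring A] [Algebra k A] [AddCommGroup I]
    [Module k I] (κ : (A →ₗ[k] I) →ₗ[k] I) {n : ℕ}
    (f : MultilinearMap k (fun _ : Fin (n + 1) => A) I) :
    MultilinearMap k (fun _ : Fin n => A) I where
  toFun x := κ (firstVariable f x)
  map_update_add' x i y z := by
    rw [← map_add]
    congr 1
    ext a
    exact (f.curryLeft a).map_update_add x i y z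
  map_update_smul' x i c y := by
    rw [← map_smul]
    congr 1
    ext a
    exact (f.curryLeft a).map_update_smul x i c y

variable {k A I : Type*} [CommRing k] [Ring A] [Algebra k A]
  [AddCommGroup I] [Module k I] [Module A I] [Module Aᵐᵒᵖ I] [SMulCommClass A Aᵐᵒᵖ I]
  [IsScalarTower k A I] [IsScalarTower k Aᵐᵒᵖ I]

/-- A retraction `κ` of the map `I → Hom_k(A, I)`, `y ↦ (a ↦ a y)`, that respects the two actions
of `A`. -/
structure IsCoinducedRetraction (κ : (A →ₗ[k] I) →ₗ[k] I) : Prop where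
  apply_action : ∀ (f : A →ₗ[k] I) y, (∀ a, f a = a • y) → κ f = y
  smul_apply : ∀ (f g : A →ₗ[k] I) (a : A), (∀ b, g b = f (b * a)) → a • κ f = κ g
  op_smul_apply : ∀ (f g : A →ₗ[k] I) (a : A), (∀ b, g b = op a • f b) → op a • κ f = κ g

theorem contractNth_succ_cons {A : Type*} [Mul A] {n : ℕ} (j : Fin (n + 1)) (a : A)
    (x : Fin (n + 1) → A) :
    Fin.contractNth j.succ (· * ·) (Fin.cons a x : Fin (n + 2) → A) =
      Fin.cons a (Fin.contractNth j (· * ·) x) := by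
  funext q
  refine Fin.cases ?_ (fun q => ?_) q
  · simp [Fin.contractNth]
  · simp [Fin.contractNth]

theorem contractNth_zero_cons {A : Type*} [Mul A] {n : ℕ} (a : A) (x : Fin (n + 1) → A) :
    Fin.contractNth 0 (· * ·) (Fin.cons a x : Fin (n + 2) → A) =
      Fin.cons (a * x 0) (Fin.tail x) := by
  funext q
  refine Fin.cases ?_ (fun q => ?_) q
  · simp [Fin.contractNth]
  · simp [Fin.contractNth, Fin.tail]

theorem init_cons {A : Type*} {n : ℕ} (a : A) (x : Fin (n + 1) → A) :
    Fin.init (Fin.cons a x : Fin (n + 2) → A) = (Fin.cons a (Fin.init x) : Fin (n + 1) → A) := by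
  funext q
  refine Fin.cases ?_ (fun q => ?_) q
  · simp [Fin.init]
  · simp [Fin.init]

/-- The cocycle identity at `(a, x₀, …, xₙ)`, solved for its first face, expresses `a ↦ a • f x`
through the other faces as functions of `a`. Applying `κ` returns `f x` on one side and, since `κ`
respects both actions, the coboundary of `contraction κ f` at `x` on the other. -/
theorem isAcyclicPos_of_isCoinducedRetraction {κ : (A →ₗ[k] I) →ₗ[k] I}
    (hκ : IsCoinducedRetraction κ) : IsAcyclicPos (d k A I) := by
  intro n f hf
  refine ⟨contraction κ f, ?_⟩
  ext x
  let g : A →ₗ[k] I := LinearMap.toSpanSingleton A I (f x) |>.restrictScalars k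
  let r : A →ₗ[k] I := Algebra.lsmul k k I (op (x (Fin.last n))) ∘ₗ firstVariable f (Fin.init x)
  have hg : g = firstVariable f (Fin.tail x) ∘ₗ LinearMap.mulRight k (x 0)
      + ∑ j : Fin n, (-1 : k) ^ ((j : ℕ) + 1) •
          firstVariable f (Fin.contractNth j.castSucc (· * ·) x)
      + (-1 : k) ^ (n + 1) • r := by
    ext a
    have h := congrArg (fun F => F (Fin.cons a x)) hf
    simp only [d_apply] at h
    rw [Fin.sum_univ_succ] at h
    simp only [← Fin.succ_castSucc, contractNth_succ_cons, Fin.castSucc_zero,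
      contractNth_zero_cons] at h
    rw [← Fin.succ_last, init_cons, Fin.cons_succ, Fin.cons_zero, Fin.tail_cons] at h
    have hl : (firstVariable f (Fin.tail x) ∘ₗ LinearMap.mulRight k (x 0)) a =
      f (Fin.cons (a * x 0) (Fin.tail x)) := rfl
    have hr : r a = op (x (Fin.last n)) • f (Fin.cons a (Fin.init x)) := rfl
    have hs : ∀ y, firstVariable f y a = f (Fin.cons a y) := fun _ => rfl
    have hga : g a = a • f x := rfl
    simp only [LinearMap.add_apply, LinearMap.sum_apply, LinearMap.smul_apply, hl, hr, hs, hga]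
    simp only [Fin.val_zero, Fin.val_succ, pow_succ _ (_ + 1), mul_neg_one, neg_smul,
      Finset.sum_neg_distrib, zero_apply] at h
    rw [← sub_eq_zero, ← h]
    simp
    abel
  rw [d_apply, ← hκ.apply_action g (f x) fun a => rfl, hg]
  simp only [map_add, map_sum, map_smul]
  congr 2
  · exact hκ.smul_apply _ _ _ fun b => rfl
  · exact hκ.op_smul_apply _ _ _ fun b => rfl

end Acyclic

end Hochschild

/-! ### Coinduced modules -/

section Coinduced

/-- The coinduced `R`-module `Hom_k(R, V)`. -/
def Coinduced (k R V : Type*) [CommRing k] [Ring R] [Algebra k R] [AddCommGroup V] [Module k V] :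
    Type _ :=
  R →ₗ[k] V

variable {k R V : Type*} [CommRing k] [Ring R] [Algebra k R] [AddCommGroup V] [Module k V]

instance : AddCommGroup (Coinduced k R V) := inferInstanceAs (AddCommGroup (R →ₗ[k] V))

instance : Module k (Coinduced k R V) := inferInstanceAs (Module k (R →ₗ[k] V))

namespace Coinduced

/-- An element of the coinduced module, as a linear map. -/
def toLinearMap : Coinduced k R V ≃ₗ[k] (R →ₗ[k] V) := LinearEquiv.refl k _

@[ext]
theorem ext {f g : Coinduced k R V} (h : ∀ r, f.toLinearMap r = g.toLinearMap r) : f = g :=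
  LinearMap.ext h

instance : Module R (Coinduced k R V) where
  smul r f := toLinearMap.symm (toLinearMap f ∘ₗ LinearMap.mulRight k r)
  one_smul f := ext fun s => congrArg f.toLinearMap (mul_one s)
  mul_smul r r' f := ext fun s => congrArg f.toLinearMap (mul_assoc s r r').symm
  smul_zero _ := rfl
  smul_add _ _ _ := rfl
  add_smul r r' f := ext fun s =>
    (congrArg f.toLinearMap (mul_add s r r')).trans (f.toLinearMap.map_add _ _)
  zero_smul f := ext fun s => (congrArg f.toLinearMap (mul_zero s)).trans f.toLinearMap.map_zero

instance : IsScalarTower k R (Coinduced k R V) :=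
  ⟨fun c r f => ext fun s =>
    (congrArg f.toLinearMap (mul_smul_comm c s r)).trans (f.toLinearMap.map_smul _ _)⟩

/-- Evaluation at `1`. -/
def evalOne : Coinduced k R V →ₗ[k] V := LinearMap.applyₗ (1 : R) ∘ₗ toLinearMap.toLinearMap

variable (k R V) in
/-- The embedding `y ↦ (r ↦ r y)` of an `R`-module in the coinduced module. -/
def unit [Module R V] [IsScalarTower k R V] : V →ₗ[R] Coinduced k R V where
  toFun y := toLinearMap.symm ((LinearMap.toSpanSingleton R V y).restrictScalars k)
  map_add' y z := ext fun r => smul_add r y z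
  map_smul' s y := ext fun r => smul_smul r s y

theorem evalOne_unit [Module R V] [IsScalarTower k R V] (y : V) : evalOne (unit k R V y) = y :=
  one_smul R y

variable (k R V) in
/-- The cokernel of the embedding of an `R`-module in the coinduced module. -/
abbrev Cokernel [Module R V] [IsScalarTower k R V] : Type _ :=
  Coinduced k R V ⧸ LinearMap.range (unit k R V)

theorem evalOne_of_mkQ_eq_zero [Module R V] [IsScalarTower k R V] (f : Coinduced k R V)
    (hf : (LinearMap.range (unit k R V)).mkQ f = 0) : unit k R V (evalOne f) = f := by
  rw [Submodule.mkQ_apply, Submodule.Quotient.mk_eq_zero] at hf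
  obtain ⟨y, rfl⟩ := hf
  rw [evalOne_unit]

/-- Evaluation at `1` is a `k`-linear retraction of `unit`. Therefore `id - unit ∘ evalOne` kills
the range of `unit` and descends to a section on the cokernel. -/
theorem exists_section [Module R V] [IsScalarTower k R V] :
    ∃ σ : Cokernel k R V →ₗ[k] Coinduced k R V,
      ∀ q, (LinearMap.range (unit k R V)).mkQ (σ q) = q := by
  let τ : Coinduced k R V →ₗ[k] Coinduced k R V :=
    LinearMap.id - (unit k R V).restrictScalars k ∘ₗ evalOne
  refine ⟨(((LinearMap.range (unit k R V)).restrictScalars k).liftQ τ ?_) ∘ₗ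
    (Submodule.Quotient.restrictScalarsEquiv k (LinearMap.range (unit k R V))).symm.toLinearMap, ?_⟩
  · rintro _ ⟨y, rfl⟩
    simp [τ, evalOne_unit]
  · intro q
    obtain ⟨f, rfl⟩ := Submodule.mkQ_surjective _ q
    change (LinearMap.range (unit k R V)).mkQ (f - unit k R V (evalOne f)) = _
    rw [map_sub, sub_eq_self]
    exact (Submodule.Quotient.mk_eq_zero _).2 ⟨_, rfl⟩

end Coinduced

end Coinduced

/-! ### Modules over `E ⊗ Cᵒᵖ` as bimodules over `E` -/

section Inflation

variable {k E C : Type*} [CommRing k] [Ring E] [Algebra k E] [Ring C] [Algebra k C]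

/-- An `E ⊗ Cᵒᵖ`-module `Y` as a bimodule over `E`, the right action being through an algebra
map `E → C`. -/
def Inflation (_π : E →ₐ[k] C) (Y : Type*) : Type _ := Y

variable (π : E →ₐ[k] C) {Y : Type*} [AddCommGroup Y] [Module k Y] [Module (E ⊗[k] Cᵐᵒᵖ) Y]

instance : AddCommGroup (Inflation π Y) := inferInstanceAs (AddCommGroup Y)

instance : Module k (Inflation π Y) := inferInstanceAs (Module k Y)

instance : Module E (Inflation π Y) :=
  (Module.compHom Y (Algebra.TensorProduct.includeLeft : E →ₐ[k] E ⊗[k] Cᵐᵒᵖ).toRingHom :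
    Module E Y)

instance : Module Eᵐᵒᵖ (Inflation π Y) :=
  (Module.compHom Y ((Algebra.TensorProduct.includeRight : Cᵐᵒᵖ →ₐ[k] E ⊗[k] Cᵐᵒᵖ).comp
    (AlgHom.op π)).toRingHom : Module Eᵐᵒᵖ Y)

namespace Inflation

/-- The identity map of `Y`. -/
def equiv : Y ≃ₗ[k] Inflation π Y := LinearEquiv.refl k Y

instance : SMulCommClass E Eᵐᵒᵖ (Inflation π Y) :=
  ⟨fun x z y => by
    change (x ⊗ₜ[k] (1 : Cᵐᵒᵖ)) • ((1 : E) ⊗ₜ[k] op (π z.unop)) • (show Y from y) =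
      ((1 : E) ⊗ₜ[k] op (π z.unop)) • (x ⊗ₜ[k] (1 : Cᵐᵒᵖ)) • (show Y from y)
    rw [smul_smul, smul_smul]
    simp⟩

variable [IsScalarTower k (E ⊗[k] Cᵐᵒᵖ) Y]

instance : IsScalarTower k E (Inflation π Y) :=
  ⟨fun c x y => by
    change ((c • x) ⊗ₜ[k] (1 : Cᵐᵒᵖ)) • (show Y from y) = c • (x ⊗ₜ[k] (1 : Cᵐᵒᵖ)) • (show Y from y)
    rw [← smul_assoc, smul_tmul']⟩

instance : IsScalarTower k Eᵐᵒᵖ (Inflation π Y) :=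
  ⟨fun c x y => by
    change ((1 : E) ⊗ₜ[k] op (π (c • x.unop))) • (show Y from y) =
      c • ((1 : E) ⊗ₜ[k] op (π x.unop)) • (show Y from y)
    rw [← smul_assoc, map_smul, op_smul, tmul_smul]⟩

/-- An `E ⊗ Cᵒᵖ`-linear map, as a `k`-linear map of bimodules. -/
def map {Z : Type*} [AddCommGroup Z] [Module k Z] [Module (E ⊗[k] Cᵐᵒᵖ) Z]
    [IsScalarTower k (E ⊗[k] Cᵐᵒᵖ) Z] (f : Y →ₗ[E ⊗[k] Cᵐᵒᵖ] Z) :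
    Inflation π Y →ₗ[k] Inflation π Z :=
  f.restrictScalars k

section

variable {Z : Type*} [AddCommGroup Z] [Module k Z] [Module (E ⊗[k] Cᵐᵒᵖ) Z]
  [IsScalarTower k (E ⊗[k] Cᵐᵒᵖ) Z] (f : Y →ₗ[E ⊗[k] Cᵐᵒᵖ] Z)

theorem map_smul (x : E) (y : Inflation π Y) : map π f (x • y) = x • map π f y :=
  LinearMap.map_smul f _ _

theorem map_op_smul (x : E) (y : Inflation π Y) : map π f (op x • y) = op x • map π f y :=
  LinearMap.map_smul f _ _

theorem d_coeffMap (n : ℕ) (g : MultilinearMap k (fun _ : Fin n => E) (Inflation π Y)) :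
    Hochschild.d k E (Inflation π Z) n (Hochschild.coeffMap E (map π f) n g) =
      Hochschild.coeffMap E (map π f) (n + 1) (Hochschild.d k E (Inflation π Y) n g) :=
  Hochschild.d_cochainMap (fun _ _ => rfl) (map_smul π f) (map_op_smul π f) n g

end

variable (Y) in
theorem exists_coinduced_splitting :
    ∃ (ρ : Inflation π (Coinduced k (E ⊗[k] Cᵐᵒᵖ) Y) →ₗ[k] Inflation π Y)
      (σ : Inflation π (Coinduced.Cokernel k (E ⊗[k] Cᵐᵒᵖ) Y) →ₗ[k]
        Inflation π (Coinduced k (E ⊗[k] Cᵐᵒᵖ) Y)),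
      (∀ y, ρ (map π (Coinduced.unit k (E ⊗[k] Cᵐᵒᵖ) Y) y) = y) ∧
      (∀ q, map π (LinearMap.range (Coinduced.unit k (E ⊗[k] Cᵐᵒᵖ) Y)).mkQ (σ q) = q) ∧
      (∀ y, map π (LinearMap.range (Coinduced.unit k (E ⊗[k] Cᵐᵒᵖ) Y)).mkQ
        (map π (Coinduced.unit k (E ⊗[k] Cᵐᵒᵖ) Y) y) = 0) ∧
      ∀ f, map π (LinearMap.range (Coinduced.unit k (E ⊗[k] Cᵐᵒᵖ) Y)).mkQ f = 0 →
        map π (Coinduced.unit k (E ⊗[k] Cᵐᵒᵖ) Y) (ρ f) = f := by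
  obtain ⟨σ, hσ⟩ := Coinduced.exists_section (k := k) (R := E ⊗[k] Cᵐᵒᵖ) (V := Y)
  have h := Coinduced.evalOne_unit (k := k) (R := E ⊗[k] Cᵐᵒᵖ) (V := Y)
  have h' := Coinduced.evalOne_of_mkQ_eq_zero (k := k) (R := E ⊗[k] Cᵐᵒᵖ) (V := Y)
  exact ⟨(equiv π).toLinearMap ∘ₗ Coinduced.evalOne ∘ₗ (equiv π).symm.toLinearMap,
    (equiv π).toLinearMap ∘ₗ σ ∘ₗ (equiv π).symm.toLinearMap, h, hσ,
    fun y => (Submodule.Quotient.mk_eq_zero _).2 ⟨y, rfl⟩, h'⟩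

theorem isShortExactComplex_coinduced :
    IsShortExactComplex (Hochschild.d k E (Inflation π Y))
      (Hochschild.d k E (Inflation π (Coinduced k (E ⊗[k] Cᵐᵒᵖ) Y)))
      (Hochschild.d k E (Inflation π (Coinduced.Cokernel k (E ⊗[k] Cᵐᵒᵖ) Y)))
      (Hochschild.coeffMap E (map π (Coinduced.unit k (E ⊗[k] Cᵐᵒᵖ) Y)))
      (Hochschild.coeffMap E
        (map π (LinearMap.range (Coinduced.unit k (E ⊗[k] Cᵐᵒᵖ) Y)).mkQ)) := by
  obtain ⟨ρ, σ, hρ, hσ, hπι, hex⟩ := exists_coinduced_splitting π Y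
  exact Hochschild.isShortExactComplex_coeffMap (map_smul π _) (map_op_smul π _) (map_smul π _)
    (map_op_smul π _) hρ hσ hπι hex

section

variable {V : Type*} [AddCommGroup V] [Module k V]

variable (V) in
/-- `f ↦ (x ⊗ c ↦ f(x)(1 ⊗ c))`. -/
def coinducedRetraction :
    (E →ₗ[k] Inflation π (Coinduced k (E ⊗[k] Cᵐᵒᵖ) V)) →ₗ[k]
      Inflation π (Coinduced k (E ⊗[k] Cᵐᵒᵖ) V) where
  toFun f := equiv π <| Coinduced.toLinearMap.symm <| TensorProduct.lift
    (LinearMap.lcomp k V (Algebra.TensorProduct.includeRight : Cᵐᵒᵖ →ₐ[k] E ⊗[k] Cᵐᵒᵖ).toLinearMap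
      ∘ₗ Coinduced.toLinearMap.toLinearMap ∘ₗ (equiv π).symm.toLinearMap ∘ₗ f)
  map_add' f g := by
    rw [← map_add, ← map_add]
    congr 2
    ext
    rfl
  map_smul' c f := by
    rw [RingHom.id_apply, ← LinearEquiv.map_smul, ← LinearEquiv.map_smul]
    congr 2
    ext
    rfl

theorem coinducedRetraction_apply (f : E →ₗ[k] Inflation π (Coinduced k (E ⊗[k] Cᵐᵒᵖ) V)) (x : E)
    (c : Cᵐᵒᵖ) : ((equiv π).symm (coinducedRetraction π V f)).toLinearMap (x ⊗ₜ c) =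
      ((equiv π).symm (f x)).toLinearMap (1 ⊗ₜ c) := rfl

theorem coinduced_ext {y z : Inflation π (Coinduced k (E ⊗[k] Cᵐᵒᵖ) V)}
    (h : ∀ x c, ((equiv π).symm y).toLinearMap (x ⊗ₜ c) = ((equiv π).symm z).toLinearMap (x ⊗ₜ c)) :
    y = z :=
  TensorProduct.ext' (g := ((equiv π).symm y).toLinearMap) h

theorem smul_apply_tmul (x : E) (y : Inflation π (Coinduced k (E ⊗[k] Cᵐᵒᵖ) V)) (z : E) (c : Cᵐᵒᵖ) :
    ((equiv π).symm (x • y)).toLinearMap (z ⊗ₜ c) =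
      ((equiv π).symm y).toLinearMap ((z * x) ⊗ₜ c) :=
  congrArg ((equiv π).symm y).toLinearMap
    ((Algebra.TensorProduct.tmul_mul_tmul z x c 1).trans (by rw [mul_one]))

theorem op_smul_apply_tmul (x : E) (y : Inflation π (Coinduced k (E ⊗[k] Cᵐᵒᵖ) V)) (z : E)
    (c : Cᵐᵒᵖ) :
    ((equiv π).symm (op x • y)).toLinearMap (z ⊗ₜ c) =
      ((equiv π).symm y).toLinearMap (z ⊗ₜ (c * op (π x))) :=
  congrArg ((equiv π).symm y).toLinearMap
    ((Algebra.TensorProduct.tmul_mul_tmul z 1 c (op (π x))).trans (by rw [mul_one]))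

/-- By adjunction `Hom_k(E ⊗ Cᵒᵖ, V) = Hom_k(E, Hom_k(Cᵒᵖ, V))`, so the module is coinduced from `k`
as a left `E`-module. The right action only touches the factor `Hom_k(Cᵒᵖ, V)`, which is why no
condition on `π` is needed. -/
theorem isCoinducedRetraction_coinducedRetraction :
    Hochschild.IsCoinducedRetraction (coinducedRetraction π V) where
  apply_action f y h := coinduced_ext π fun x c => by
    rw [coinducedRetraction_apply, h, smul_apply_tmul, one_mul]
  smul_apply f g a h := coinduced_ext π fun x c => by
    rw [smul_apply_tmul, coinducedRetraction_apply, coinducedRetraction_apply, h]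
  op_smul_apply f g a h := coinduced_ext π fun x c => by
    rw [op_smul_apply_tmul, coinducedRetraction_apply, coinducedRetraction_apply, h,
      op_smul_apply_tmul]

variable (V) in
theorem isAcyclicPos_coinduced :
    IsAcyclicPos (Hochschild.d k E (Inflation π (Coinduced k (E ⊗[k] Cᵐᵒᵖ) V))) :=
  Hochschild.isAcyclicPos_of_isCoinducedRetraction (isCoinducedRetraction_coinducedRetraction π)

end

end Inflation

end Inflation

/-! ### Relative Ext -/

namespace RelProjResolution

section HomComplex

variable {k : Type u} [CommRing k] {R : Type v} [Ring R] [Algebra k R]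
  {N : Type w} [AddCommGroup N] [Module k N] [Module R N]
  (Q : RelProjResolution.{u, v, w, x} k R N)

/-- Post-composition with an `R`-linear map. -/
def homMap {Y Z : Type*} [AddCommGroup Y] [Module k Y] [Module R Y] [IsScalarTower k R Y]
    [AddCommGroup Z] [Module k Z] [Module R Z] [IsScalarTower k R Z] (g : Y →ₗ[R] Z) (n : ℕ) :
    (Q.P n →ₗ[R] Y) →ₗ[k] (Q.P n →ₗ[R] Z) where
  toFun f := g ∘ₗ f
  map_add' f f' := LinearMap.comp_add _ _ _
  map_smul' c f := by
    ext p
    exact (g.restrictScalars k).map_smul c (f p)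

theorem homD_homD {Y : Type*} [AddCommGroup Y] [Module k Y] [Module R Y] [IsScalarTower k R Y]
    (n : ℕ) (f : Q.P n →ₗ[R] Y) : Q.homD Y (n + 1) (Q.homD Y n f) = 0 := by
  change (f ∘ₗ Q.d n) ∘ₗ Q.d (n + 1) = 0
  rw [LinearMap.comp_assoc, Q.d_comp_d, LinearMap.comp_zero]

/-- By adjunction `Hom_R(P, Hom_k(R, V)) = Hom_k(P, V)`, and `P` is contractible over `k`. The
bounding cochain is `f ∘ s` carried through the adjunction. -/
theorem isAcyclicPos_homD_coinduced (V : Type*) [AddCommGroup V] [Module k V] :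
    IsAcyclicPos (Q.homD (Coinduced k R V)) := by
  obtain ⟨t, s, -, -, hs⟩ := Q.contractible
  intro n f hf
  let g : Q.P n →ₗ[R] Coinduced k R V :=
    { toFun := fun p => Coinduced.toLinearMap.symm (Coinduced.evalOne ∘ₗ f.restrictScalars k ∘ₗ s n
        ∘ₗ (LinearMap.toSpanSingleton R (Q.P n) p).restrictScalars k)
      map_add' := fun p q => Coinduced.ext fun r => by
        change Coinduced.evalOne (f (s n (r • (p + q)))) =
          Coinduced.evalOne (f (s n (r • p))) + Coinduced.evalOne (f (s n (r • q)))
        rw [smul_add, map_add, map_add, map_add]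
      map_smul' := fun a p => Coinduced.ext fun r => by
        change Coinduced.evalOne (f (s n (r • a • p))) = Coinduced.evalOne (f (s n ((r * a) • p)))
        rw [smul_smul] }
  refine ⟨g, LinearMap.ext fun p => Coinduced.ext fun r => ?_⟩
  change Coinduced.evalOne (f (s n (r • Q.d n p))) = _
  have h1 : s n (r • Q.d n p) = r • p - Q.d (n + 1) (s (n + 1) (r • p)) := by
    rw [← map_smul]
    exact eq_sub_of_add_eq' (hs n (r • p))
  have h2 : f (Q.d (n + 1) (s (n + 1) (r • p))) = 0 := LinearMap.congr_fun hf _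
  rw [h1, map_sub, h2, sub_zero, map_smul]
  exact congrArg (f p).toLinearMap (one_mul r)

end HomComplex

end RelProjResolution

/-! ### Homomorphisms from the standard resolution into a coinduced extension -/

section StandardResolution

variable {k : Type u} [CommRing k] {R : Type v} [Ring R] [Algebra k R]
  {N : Type w} [AddCommGroup N] [Module k N] [Module R N] [IsScalarTower k R N]

/-- `IsRelProjective` tests modules of a single universe only. The lift for `R ⊗ K` is built again
here so that the cokernels of coinduced modules, which may live in a different universe, are
covered. -/
theorem exists_lift_of_tensor {K Y Z : Type*} [AddCommGroup K] [Module k K]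
    [AddCommGroup Y] [Module k Y] [Module R Y] [IsScalarTower k R Y]
    [AddCommGroup Z] [Module k Z] [Module R Z] [IsScalarTower k R Z] {g : Y →ₗ[R] Z}
    {s : Z →ₗ[k] Y} (hs : ∀ z, g (s z) = z) (f : R ⊗[k] K →ₗ[R] Z) :
    ∃ f' : R ⊗[k] K →ₗ[R] Y, g ∘ₗ f' = f := by
  refine ⟨AlgebraTensorModule.lift
    (LinearMap.toSpanSingleton R _ (s ∘ₗ (f.restrictScalars k) ∘ₗ TensorProduct.mk k R K 1)), ?_⟩
  ext x
  simp [hs]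

theorem exists_lift_of_standardResolution {Y Z : Type*}
    [AddCommGroup Y] [Module k Y] [Module R Y] [IsScalarTower k R Y]
    [AddCommGroup Z] [Module k Z] [Module R Z] [IsScalarTower k R Z] {g : Y →ₗ[R] Z}
    {s : Z →ₗ[k] Y} (hs : ∀ z, g (s z) = z) :
    ∀ (n : ℕ) (f : (standardResolution k R N).P n →ₗ[R] Z),
      ∃ f' : (standardResolution k R N).P n →ₗ[R] Y, g ∘ₗ f' = f
  | 0, f => exists_lift_of_tensor hs f
  | n + 1, f => exists_lift_of_tensor (K := (syzygy k R N n).carrier) hs f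

variable (k R N) in
-- Only surjectivity uses the resolution: the map onto the cokernel splits over `k`, and the terms
-- of the resolution lift through such maps.
theorem isShortExactComplex_homMap_coinduced (Y : Type*) [AddCommGroup Y] [Module k Y]
    [Module R Y] [IsScalarTower k R Y] :
    IsShortExactComplex ((standardResolution k R N).homD Y)
      ((standardResolution k R N).homD (Coinduced k R Y))
      ((standardResolution k R N).homD (Coinduced.Cokernel k R Y))
      ((standardResolution k R N).homMap (Coinduced.unit k R Y))
      ((standardResolution k R N).homMap (LinearMap.range (Coinduced.unit k R Y)).mkQ) where
  comm_left _ _ := rfl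
  comm_right _ _ := rfl
  injective n f g h := LinearMap.ext fun p => by
    have := congrArg Coinduced.evalOne (LinearMap.congr_fun h p)
    rwa [← Coinduced.evalOne_unit (R := R) (k := k) (f p),
      ← Coinduced.evalOne_unit (R := R) (k := k) (g p)]
  exact n f := by
    constructor
    · intro hf
      have hl : ∀ p, Coinduced.unit k R Y (Coinduced.evalOne (f p)) = f p := fun p =>
        Coinduced.evalOne_of_mkQ_eq_zero _ (LinearMap.congr_fun hf p)
      -- Evaluation at `1` is only `k`-linear. The map `p ↦ evalOne (f p)` is nevertheless
      -- `R`-linear, because composing it with the injective `R`-linear map `unit` gives `f`.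
      have hinj : Function.Injective (Coinduced.unit k R Y) :=
        Function.LeftInverse.injective Coinduced.evalOne_unit
      refine ⟨{ toFun := fun p => Coinduced.evalOne (f p)
                map_add' := fun p q => by rw [map_add, map_add]
                map_smul' := fun r p => hinj (by
                  rw [hl, map_smul, RingHom.id_apply, map_smul, hl]) }, ?_⟩
      exact LinearMap.ext hl
    · rintro ⟨g, rfl⟩
      exact LinearMap.ext fun p => (Submodule.Quotient.mk_eq_zero _).2 ⟨g p, rfl⟩
  surjective n f := by
    obtain ⟨σ, hσ⟩ := Coinduced.exists_section (k := k) (R := R) (V := Y)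
    exact exists_lift_of_standardResolution hσ n f

end StandardResolution

/-! ### Comparison of relative Ext with Hochschild cohomology -/

section Comparison

variable {k : Type u} {E C : Type*} [CommRing k] [Ring E] [Algebra k E] [Ring C] [Algebra k C]
  (π : E →ₐ[k] C) {N : Type w} [AddCommGroup N] [Module k N] [Module (E ⊗[k] Cᵐᵒᵖ) N]
  (Q : RelProjResolution k (E ⊗[k] Cᵐᵒᵖ) N)

/-- The universal Hochschild cochains of a relative projective resolution of `N`, over an
element of `N` on which the two actions of `E` agree. -/
theorem exists_universal_cochains {y : N}
    (hy : ∀ e : E, (e ⊗ₜ[k] (1 : Cᵐᵒᵖ)) • y = ((1 : E) ⊗ₜ[k] op (π e)) • y) :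
    ∃ θ : ∀ n, MultilinearMap k (fun _ : Fin n => E) (Inflation π (Q.P n)),
      (∀ g, Q.aug ((Inflation.equiv π).symm (θ 0 g)) = y) ∧
      ∀ n, Hochschild.d k E (Inflation π (Q.P n)) n (θ n) =
        Hochschild.coeffMap E (Inflation.map π (Q.d n)) (n + 1) (θ (n + 1)) := by
  obtain ⟨t, s, ht, hs0, hs⟩ := Q.contractible
  let S : ∀ n, Inflation π (Q.P n) →ₗ[k] Inflation π (Q.P (n + 1)) := fun n => s n
  -- Recursively `θ₀ = t y` and `θₙ₊₁ = sₙ ∘ dθₙ`. The homotopy identity gives the required relation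
  -- once `dθₙ` is known to be killed by the map leaving `Pₙ`: the augmentation for `n = 0`, the
  -- previous differential otherwise.
  let θ : ∀ n, MultilinearMap k (fun _ : Fin n => E) (Inflation π (Q.P n)) := fun n =>
    Nat.rec (MultilinearMap.constOfIsEmpty k _ (Inflation.equiv π (t y)))
      (fun n f => Hochschild.coeffMap E (S n) (n + 1) (Hochschild.d k E _ n f)) n
  refine ⟨θ, fun _ => ht y, fun n => ?_⟩
  induction n with
  | zero =>
    ext g
    change _ = Q.d 0 (s 0 (Hochschild.d k E _ 0 (θ 0) g))
    have h := hs0 (Hochschild.d k E (Inflation π (Q.P 0)) 0 (θ 0) g)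
    -- The augmentation sends `dθ₀(e)` to `e y - y π(e)`, which vanishes by `hy`.
    have h0 : Q.aug (Hochschild.d k E (Inflation π (Q.P 0)) 0 (θ 0) g) = 0 := by
      have h1 : Hochschild.d k E (Inflation π (Q.P 0)) 0 (θ 0) g =
          (Inflation.equiv π (((g 0) ⊗ₜ[k] (1 : Cᵐᵒᵖ)) • t y -
            ((1 : E) ⊗ₜ[k] op (π (g 0))) • t y)) := by
        rw [Hochschild.d_apply]
        simp [sub_eq_add_neg]
        rfl
      rw [h1]
      change Q.aug (_ - _) = 0
      rw [map_sub, map_smul, map_smul, ht, hy, sub_self]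
    rw [h0, map_zero, add_zero] at h
    exact h.symm
  | succ n ih =>
    ext g
    have h := hs n (Hochschild.d k E (Inflation π (Q.P (n + 1))) (n + 1) (θ (n + 1)) g)
    -- By induction the differential carries `dθₙ₊₁` to `d(dθₙ) = 0`.
    have h0 : Q.d n (Hochschild.d k E (Inflation π (Q.P (n + 1))) (n + 1) (θ (n + 1)) g) = 0 := by
      have := Inflation.d_coeffMap π (Q.d n) (n + 1) (θ (n + 1))
      rw [← ih, Hochschild.d_d_apply] at this
      exact (congrArg (fun F => F g) this).symm
    rw [h0, map_zero, add_zero] at h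
    exact h.symm

variable {π Q} in
/-- The cochain map `Hom_R(P, Y) → C(E, Y)` given by universal cochains. -/
def extComparison (θ : ∀ n, MultilinearMap k (fun _ : Fin n => E) (Inflation π (Q.P n)))
    (Y : Type*) [AddCommGroup Y] [Module k Y] [Module (E ⊗[k] Cᵐᵒᵖ) Y]
    [IsScalarTower k (E ⊗[k] Cᵐᵒᵖ) Y] (n : ℕ) :
    (Q.P n →ₗ[E ⊗[k] Cᵐᵒᵖ] Y) →ₗ[k] MultilinearMap k (fun _ : Fin n => E) (Inflation π Y) where
  toFun f := Hochschild.coeffMap E (Inflation.map π f) n (θ n)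
  map_add' _ _ := rfl
  map_smul' _ _ := rfl

end Comparison

theorem Hochschild.d_zero_apply {k A X : Type*} [CommRing k] [Ring A] [Algebra k A]
    [AddCommGroup X] [Module k X] [Module A X] [Module Aᵐᵒᵖ X] [SMulCommClass A Aᵐᵒᵖ X]
    [IsScalarTower k A X] [IsScalarTower k Aᵐᵒᵖ X]
    (f : MultilinearMap k (fun _ : Fin 0 => A) X) (g : Fin 1 → A) (g₀ : Fin 0 → A) :
    Hochschild.d k A X 0 f g = g 0 • f g₀ - op (g 0) • f g₀ := by
  rw [Hochschild.d_apply, Subsingleton.elim (Fin.tail g) g₀, Subsingleton.elim (Fin.init g) g₀]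
  simp [sub_eq_add_neg]

theorem Hochschild.d_zero_eq_zero_iff {k A X : Type*} [CommRing k] [Ring A] [Algebra k A]
    [AddCommGroup X] [Module k X] [Module A X] [Module Aᵐᵒᵖ X] [SMulCommClass A Aᵐᵒᵖ X]
    [IsScalarTower k A X] [IsScalarTower k Aᵐᵒᵖ X]
    (f : MultilinearMap k (fun _ : Fin 0 => A) X) (g₀ : Fin 0 → A) :
    Hochschild.d k A X 0 f = 0 ↔ ∀ a : A, a • f g₀ = op a • f g₀ := by
  constructor
  · intro h a
    have := Hochschild.d_zero_apply f (fun _ => a) g₀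
    rw [h, zero_apply] at this
    exact (sub_eq_zero.1 this.symm)
  · intro h
    ext g
    rw [Hochschild.d_zero_apply f g g₀, h, sub_self, zero_apply]

section Triangular

variable (k : Type*) (A M B : Type*) [CommRing k] [Ring A] [Algebra k A] [Ring B] [Algebra k B]
  [AddCommGroup M] [Module k M] [Module A M] [Module Bᵐᵒᵖ M] [SMulCommClass A Bᵐᵒᵖ M]
  [IsScalarTower k A M] [IsScalarTower k Bᵐᵒᵖ M]

/-- The projection of the triangular algebra onto `B`, as a map of `k`-algebras. -/
def projBAlgHom : Triangular A M B →ₐ[k] B :=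
  AlgHom.mk' (projB A M B) fun _ _ => rfl

/-- The projection of the triangular algebra onto `A`, as a map of `k`-algebras. -/
def projAAlgHom : Triangular A M B →ₐ[k] A :=
  AlgHom.mk'
    { toFun := fun x => x.a
      map_one' := rfl
      map_mul' := fun _ _ => rfl
      map_zero' := rfl
      map_add' := fun _ _ => rfl } fun _ _ => rfl

end Triangular

/-! ### The relative Ext of `B_E` as Hochschild cohomology of `E` -/

section ExtBE

variable {k : Type*} {A M B : Type*} [CommRing k] [Ring A] [Algebra k A] [Ring B] [Algebra k B]
  [AddCommGroup M] [Module k M] [Module A M] [Module Bᵐᵒᵖ M] [SMulCommClass A Bᵐᵒᵖ M]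
  [IsScalarTower k A M] [IsScalarTower k Bᵐᵒᵖ M]

/-- As an `E ⊗ Bᵒᵖ`-module, `B_E` is generated by `1` subject to the relations `e · 1 = 1 · e.b`.
The elements `y` satisfying them are the degree 0 Hochschild cocycles of `Inflation (projBAlgHom k A
M B) Y`. -/
theorem exists_linearMap_BE {Y : Type*} [AddCommGroup Y] [Module k Y]
    [Module (Triangular A M B ⊗[k] Bᵐᵒᵖ) Y] [IsScalarTower k (Triangular A M B ⊗[k] Bᵐᵒᵖ) Y] {y : Y}
    (hy : ∀ e : Triangular A M B,
      (e ⊗ₜ[k] (1 : Bᵐᵒᵖ)) • y = ((1 : Triangular A M B) ⊗ₜ[k] op e.b) • y) :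
    ∃ φ : BE A M B →ₗ[Triangular A M B ⊗[k] Bᵐᵒᵖ] Y, φ (1 : B) = y := by
  let φ : BE A M B →+ Y :=
    AddMonoidHom.mk' (fun b => ((1 : Triangular A M B) ⊗ₜ[k] @op B b) • y) fun b c =>
      (congrArg (· • y) (tmul_add (1 : Triangular A M B) (@op B b) (@op B c))).trans
        (add_smul _ _ y)
  have key : ∀ (e : Triangular A M B) (c b : B),
      ((1 : Triangular A M B) ⊗ₜ[k] op (e.b * (b * c))) • y =
        (e ⊗ₜ[k] op c) • ((1 : Triangular A M B) ⊗ₜ[k] op b) • y := by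
    intro e c b
    -- The two tensor factors commute, so `e` can be moved next to `y`, where `hy` applies.
    have h : (e ⊗ₜ[k] op c) * ((1 : Triangular A M B) ⊗ₜ[k] op b) =
        ((1 : Triangular A M B) ⊗ₜ[k] (op c * op b)) * (e ⊗ₜ[k] (1 : Bᵐᵒᵖ)) := by
      simp
    rw [smul_smul, h, mul_smul, hy, smul_smul]
    simp [mul_assoc]
  refine ⟨{ toFun := φ, map_add' := φ.map_add, map_smul' := fun r b => ?_ }, ?_⟩
  · rw [RingHom.id_apply]
    induction r using TensorProduct.induction_on with
    | zero =>
      exact (congrArg φ (zero_smul (Triangular A M B ⊗[k] Bᵐᵒᵖ) b)).trans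
        (φ.map_zero.trans (zero_smul (Triangular A M B ⊗[k] Bᵐᵒᵖ) (φ b)).symm)
    | add r s hr hs => rw [add_smul, add_smul, ← hr, ← hs, φ.map_add]
    | tmul e c => exact key e c.unop b
  · change ((1 : Triangular A M B) ⊗ₜ[k] op (1 : B)) • y = y
    rw [op_one, ← Algebra.TensorProduct.one_def, one_smul]

/-- The relative resolution of `B_E`. -/
abbrev resolutionBE (k A M B : Type*) [CommRing k] [Ring A] [Algebra k A] [Ring B] [Algebra k B]
    [AddCommGroup M] [Module k M] [Module A M] [Module Bᵐᵒᵖ M] [SMulCommClass A Bᵐᵒᵖ M]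
    [IsScalarTower k A M] [IsScalarTower k Bᵐᵒᵖ M] :
    RelProjResolution k (Triangular A M B ⊗[k] Bᵐᵒᵖ) (BE A M B) :=
  standardResolution k (Triangular A M B ⊗[k] Bᵐᵒᵖ) (BE A M B)

variable {θ : ∀ n, MultilinearMap k (fun _ : Fin n => Triangular A M B)
    (Inflation (projBAlgHom k A M B) ((resolutionBE k A M B).P n))}

theorem d_extComparison
    (hθ : ∀ n, Hochschild.d k (Triangular A M B) _ n (θ n) = Hochschild.coeffMap _
      (Inflation.map (projBAlgHom k A M B) ((resolutionBE k A M B).d n)) (n + 1) (θ (n + 1)))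
    {Y : Type*} [AddCommGroup Y] [Module k Y]
    [Module (Triangular A M B ⊗[k] Bᵐᵒᵖ) Y] [IsScalarTower k (Triangular A M B ⊗[k] Bᵐᵒᵖ) Y]
    (n : ℕ) (f : (resolutionBE k A M B).P n →ₗ[Triangular A M B ⊗[k] Bᵐᵒᵖ] Y) :
    Hochschild.d k (Triangular A M B) _ n (extComparison θ Y n f) =
      extComparison θ Y (n + 1) ((resolutionBE k A M B).homD Y n f) := by
  have := Inflation.d_coeffMap (projBAlgHom k A M B) f n (θ n)
  rw [hθ] at this
  exact this

/-- A degree 0 cocycle factors through the augmentation as some `φ : B_E → Y`. Since `θ₀` lies over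
`1`, the comparison is `φ ↦ φ(1)`, and `exists_linearMap_BE` inverts it. -/
theorem isQuasiIsoAt_extComparison_zero
    (h0 : ∀ g, (resolutionBE k A M B).aug
      ((Inflation.equiv (projBAlgHom k A M B)).symm (θ 0 g)) = (1 : B))
    (Y : Type*) [AddCommGroup Y] [Module k Y]
    [Module (Triangular A M B ⊗[k] Bᵐᵒᵖ) Y] [IsScalarTower k (Triangular A M B ⊗[k] Bᵐᵒᵖ) Y] :
    IsQuasiIsoAt ((resolutionBE k A M B).homD Y)
      (Hochschild.d k (Triangular A M B) (Inflation (projBAlgHom k A M B) Y))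
      (extComparison θ Y) 0 where
  injective c hc hηc := by
    obtain ⟨t, s, -, hs, -⟩ := (resolutionBE k A M B).contractible
    -- The element `p - t (aug p)` is a boundary, and the cocycle `c` kills boundaries.
    have hdet : ∀ p, c p = c (t ((resolutionBE k A M B).aug p)) := by
      intro p
      conv_lhs => rw [← hs p]
      rw [map_add, add_eq_right]
      exact LinearMap.congr_fun hc _
    let p₀ := (Inflation.equiv (projBAlgHom k A M B)).symm (θ 0 Fin.elim0)
    have hz : c p₀ = 0 := congrArg (fun F => F Fin.elim0) (show extComparison θ Y 0 c = 0 from hηc)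
    refine LinearMap.ext fun p => ?_
    -- The element `p₀` lies over the generator `1`, so some multiple of it lies over `aug p`; `c`
    -- takes the same value on both, and it vanishes on `p₀`.
    have hp : (resolutionBE k A M B).aug
        (((1 : Triangular A M B) ⊗ₜ[k] op (show B from (resolutionBE k A M B).aug p)) • p₀) =
        (resolutionBE k A M B).aug p := by
      rw [map_smul, h0]
      exact (one_mul (M := B) _).trans (one_mul (M := B) _)
    rw [hdet, ← hp, ← hdet, map_smul, hz, smul_zero]
    rfl
  surjective b hb := by
    have hb' := (Hochschild.d_zero_eq_zero_iff b Fin.elim0).1 hb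
    obtain ⟨φ, hφ⟩ := exists_linearMap_BE
      (y := (Inflation.equiv (projBAlgHom k A M B)).symm (b Fin.elim0)) hb'
    refine ⟨φ ∘ₗ (resolutionBE k A M B).aug, ?_, ?_⟩
    · change (φ ∘ₗ _) ∘ₗ _ = 0
      rw [LinearMap.comp_assoc, (resolutionBE k A M B).aug_comp_d, LinearMap.comp_zero]
    · have : b = extComparison θ Y 0 (φ ∘ₗ (resolutionBE k A M B).aug) := by
        ext g
        rw [Subsingleton.elim g Fin.elim0]
        exact (hφ.symm.trans (congrArg φ (h0 _).symm))
      rw [← this, sub_self]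
      exact zero_mem _

/-- Dimension shifting along `Y → Hom_k(R, Y) → Coinduced.Cokernel k R Y`, with `R = E ⊗ Bᵒᵖ`: the
middle term is acyclic in positive degrees for both theories. -/
theorem isQuasiIsoAt_extComparison_succ
    (h0 : ∀ g, (resolutionBE k A M B).aug
      ((Inflation.equiv (projBAlgHom k A M B)).symm (θ 0 g)) = (1 : B))
    (hθ : ∀ n, Hochschild.d k (Triangular A M B) _ n (θ n) = Hochschild.coeffMap _
      (Inflation.map (projBAlgHom k A M B) ((resolutionBE k A M B).d n)) (n + 1) (θ (n + 1)))
    (Y : Type*) [AddCommGroup Y] [Module k Y]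
    [Module (Triangular A M B ⊗[k] Bᵐᵒᵖ) Y] [IsScalarTower k (Triangular A M B ⊗[k] Bᵐᵒᵖ) Y]
    (n : ℕ)
    (h : IsQuasiIsoAt ((resolutionBE k A M B).homD
        (Coinduced.Cokernel k (Triangular A M B ⊗[k] Bᵐᵒᵖ) Y))
      (Hochschild.d k (Triangular A M B) (Inflation (projBAlgHom k A M B)
        (Coinduced.Cokernel k (Triangular A M B ⊗[k] Bᵐᵒᵖ) Y)))
      (extComparison θ _) n) :
    IsQuasiIsoAt ((resolutionBE k A M B).homD Y)
      (Hochschild.d k (Triangular A M B) (Inflation (projBAlgHom k A M B) Y))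
      (extComparison θ Y) (n + 1) :=
  IsQuasiIsoAt.succ_of_isShortExactComplex
    (isShortExactComplex_homMap_coinduced k (Triangular A M B ⊗[k] Bᵐᵒᵖ) (BE A M B) Y)
    (Inflation.isShortExactComplex_coinduced (projBAlgHom k A M B))
    (d_extComparison hθ) (fun _ _ => rfl) (fun _ _ => rfl)
    (RelProjResolution.homD_homD _) Hochschild.d_d_apply
    (RelProjResolution.isAcyclicPos_homD_coinduced _ _)
    (Inflation.isAcyclicPos_coinduced _ _)
    (isQuasiIsoAt_extComparison_zero h0 _) n h

end ExtBE

section ExtBEUniverse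

universe u₁ u₂ u₃ u₄ u₅

variable {k : Type u₁} {A : Type u₂} {M : Type u₃} {B : Type u₄}
  [CommRing k] [Ring A] [Algebra k A] [Ring B] [Algebra k B]
  [AddCommGroup M] [Module k M] [Module A M] [Module Bᵐᵒᵖ M] [SMulCommClass A Bᵐᵒᵖ M]
  [IsScalarTower k A M] [IsScalarTower k Bᵐᵒᵖ M]
  {θ : ∀ n, MultilinearMap k (fun _ : Fin n => Triangular A M B)
    (Inflation (projBAlgHom k A M B) ((resolutionBE k A M B).P n))}

/-- Passing to the cokernel may raise the universe, but `max u₂ u₃ u₄ u₅` is stable under it, so the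
induction runs there. For general `Y`, a single shift leads into this universe. -/
theorem isQuasiIsoAt_extComparison_of_large
    (h0 : ∀ g, (resolutionBE k A M B).aug
      ((Inflation.equiv (projBAlgHom k A M B)).symm (θ 0 g)) = (1 : B))
    (hθ : ∀ n, Hochschild.d k (Triangular A M B) _ n (θ n) = Hochschild.coeffMap _
      (Inflation.map (projBAlgHom k A M B) ((resolutionBE k A M B).d n)) (n + 1) (θ (n + 1)))
    (n : ℕ) (Y : Type (max u₂ u₃ u₄ u₅)) [AddCommGroup Y] [Module k Y]
    [Module (Triangular A M B ⊗[k] Bᵐᵒᵖ) Y] [IsScalarTower k (Triangular A M B ⊗[k] Bᵐᵒᵖ) Y] :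
    IsQuasiIsoAt ((resolutionBE k A M B).homD Y)
      (Hochschild.d k (Triangular A M B) (Inflation (projBAlgHom k A M B) Y))
      (extComparison θ Y) n := by
  induction n generalizing Y with
  | zero => exact isQuasiIsoAt_extComparison_zero h0 Y
  | succ n ih => exact isQuasiIsoAt_extComparison_succ h0 hθ Y n (ih _)

theorem nonempty_relExt_linearEquiv (Y : Type u₅) [AddCommGroup Y] [Module k Y]
    [Module (Triangular A M B ⊗[k] Bᵐᵒᵖ) Y] [IsScalarTower k (Triangular A M B ⊗[k] Bᵐᵒᵖ) Y]
    (n : ℕ) :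
    Nonempty (RelExt k (Triangular A M B ⊗[k] Bᵐᵒᵖ) (BE A M B) Y n ≃ₗ[k]
      Hochschild.H k (Triangular A M B) (Inflation (projBAlgHom k A M B) Y) n) := by
  obtain ⟨θ, h0, hθ⟩ := exists_universal_cochains (projBAlgHom k A M B) (resolutionBE k A M B)
    (y := (1 : B)) fun e => by
      change (e.b * (1 * 1) : B) = (1 * (1 * e.b) : B)
      simp
  refine IsQuasiIsoAt.nonempty_linearEquiv (d_extComparison hθ) (g := extComparison θ Y) ?_
  cases n with
  | zero => exact isQuasiIsoAt_extComparison_zero h0 Y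
  | succ n =>
    exact isQuasiIsoAt_extComparison_succ h0 hθ Y n
      (isQuasiIsoAt_extComparison_of_large.{u₁, u₂, u₃, u₄, u₅} h0 hθ n _)

end ExtBEUniverse

/-! ### The corner `1_A X 1_A` -/

section Corner

set_option linter.unusedSectionVars false

variable {k A M B : Type*} [CommRing k] [Ring A] [Algebra k A] [Ring B] [Algebra k B]
  [AddCommGroup M] [Module k M] [Module A M] [Module Bᵐᵒᵖ M] [SMulCommClass A Bᵐᵒᵖ M]
  [IsScalarTower k A M] [IsScalarTower k Bᵐᵒᵖ M]

variable (k M B) in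
/-- The inclusion of `A` in the triangular algebra, as a `k`-linear map. -/
def inclALinear : A →ₗ[k] Triangular A M B where
  toFun := inclA M B
  map_add' := map_add _
  map_smul' c a := by ext <;> simp

theorem inclALinear_mul (a b : A) :
    inclALinear k M B (a * b) = inclALinear k M B a * inclALinear k M B b := map_mul (inclA M B) a b

/-- The triangular shape enters here, as `E 1_A = A`, and in `eB_mul`, as `1_B E = B`. -/
theorem mul_eA (x : Triangular A M B) : x * eA A M B = inclA M B x.a := by
  ext <;> simp [eA]

theorem eA_mul_inclA (a : A) : eA A M B * inclA M B a = inclA M B a := by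
  ext <;> simp [eA]

theorem eB_mul (x : Triangular A M B) : eB A M B * x = inclB A M x.b := by
  ext <;> simp [eB]

theorem eB_mul_eA : eB A M B * eA A M B = 0 := by
  ext <;> simp [eA, eB]

theorem eA_add_eB : eA A M B + eB A M B = 1 := by
  ext <;> simp [eA, eB]

section

variable {X : Type*}
  [AddCommGroup X] [Module k X] [Module (Triangular A M B) X] [Module (Triangular A M B)ᵐᵒᵖ X]
  [SMulCommClass (Triangular A M B) (Triangular A M B)ᵐᵒᵖ X]
  [IsScalarTower k (Triangular A M B) X] [IsScalarTower k (Triangular A M B)ᵐᵒᵖ X]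

variable (k A M B X) in
/-- The projection `x ↦ 1_A x 1_A` of a bimodule onto its corner. -/
def cornerProj : X →ₗ[k] XAA k A M B X where
  toFun x := ⟨eA A M B • op (eA A M B) • x, x, rfl⟩
  map_add' x y := Subtype.ext (by simp)
  map_smul' c x := Subtype.ext (by
    change eA A M B • op (eA A M B) • c • x = c • eA A M B • op (eA A M B) • x
    rw [smul_comm _ c, smul_comm _ c])

theorem coe_cornerProj (x : X) :
    (cornerProj k A M B X x : X) = eA A M B • op (eA A M B) • x := rfl

theorem cornerProj_coe (x : XAA k A M B X) : cornerProj k A M B X x = x :=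
  Subtype.ext (by rw [coe_cornerProj, op_eA_smul_of_mem, eA_smul_of_mem])

theorem cornerProj_smul (a : A) (x : X) :
    cornerProj k A M B X (inclA M B a • x) = a • cornerProj k A M B X x :=
  Subtype.ext (by
    rw [XAA.coe_smul, coe_cornerProj, coe_cornerProj, ← smul_comm (inclA M B a), smul_smul,
      smul_smul, eA_mul_inclA, mul_eA, inclA_a])

theorem cornerProj_op_smul (a : A) (x : X) :
    cornerProj k A M B X (op (inclA M B a) • x) = op a • cornerProj k A M B X x :=
  Subtype.ext (by
    rw [XAA.coe_op_smul, coe_cornerProj, coe_cornerProj, ← smul_comm (eA A M B), smul_smul (op _),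
      smul_smul (op _), ← op_mul, ← op_mul, eA_mul_inclA, mul_eA, inclA_a])

/-- Since `E 1_A = A`, the corner is stable under the left action of all of `E`, which acts on it
through the projection to `A`. -/
theorem smul_coe_XAA (x : Triangular A M B) (y : XAA k A M B X) :
    x • (y : X) = inclA M B x.a • (y : X) := by
  rw [← mul_eA, mul_smul, eA_smul_of_mem]

variable (k A M B X) in
/-- Restriction of cochains to `A`, with values in the corner. -/
abbrev restrictCorner (n : ℕ) :
    MultilinearMap k (fun _ : Fin n => Triangular A M B) X →ₗ[k]
      MultilinearMap k (fun _ : Fin n => A) (XAA k A M B X) :=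
  Hochschild.cochainMap (inclALinear k M B) (cornerProj k A M B X) n

theorem d_restrictCorner (n : ℕ) (f : MultilinearMap k (fun _ : Fin n => Triangular A M B) X) :
    Hochschild.d k A _ n (restrictCorner k A M B X n f) =
      restrictCorner k A M B X (n + 1) (Hochschild.d k (Triangular A M B) X n f) :=
  Hochschild.d_cochainMap inclALinear_mul cornerProj_smul cornerProj_op_smul n f

/-- The corner of a coinduced bimodule is coinduced. -/
theorem isAcyclicPos_corner {κ : (Triangular A M B →ₗ[k] X) →ₗ[k] X}
    (hκ : Hochschild.IsCoinducedRetraction κ) :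
    IsAcyclicPos (Hochschild.d k A (XAA k A M B X)) := by
  -- Maps on `A` are extended to `E` through the projection `E → A`. This is compatible with the
  -- action maps, because `E` acts on the left of the corner through that same projection.
  let T : (A →ₗ[k] XAA k A M B X) →ₗ[k] (Triangular A M B →ₗ[k] X) :=
    { toFun := fun f => (XAA k A M B X).subtype ∘ₗ f ∘ₗ (projAAlgHom k A M B).toLinearMap
      map_add' := fun _ _ => rfl
      map_smul' := fun _ _ => rfl }
  have hT : ∀ f x, T f x = (f x.a : X) := fun _ _ => rfl
  refine Hochschild.isAcyclicPos_of_isCoinducedRetraction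
    (κ := cornerProj k A M B X ∘ₗ κ ∘ₗ T) ⟨fun f y h => ?_, fun f g a h => ?_, fun f g a h => ?_⟩
  · have : κ (T f) = y := hκ.apply_action _ _ fun x => by
      rw [hT, h, XAA.coe_smul, ← smul_coe_XAA x y]
    rw [LinearMap.comp_apply, LinearMap.comp_apply, this, cornerProj_coe]
  · have : inclA M B a • κ (T f) = κ (T g) := hκ.smul_apply _ _ _ fun x => by
      rw [hT, hT, h, mul_a, inclA_a]
    rw [LinearMap.comp_apply, LinearMap.comp_apply, ← cornerProj_smul, this]
    rfl
  · have : op (inclA M B a) • κ (T f) = κ (T g) := hκ.op_smul_apply _ _ _ fun x => by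
      rw [hT, hT, h, XAA.coe_op_smul]
    rw [LinearMap.comp_apply, LinearMap.comp_apply, ← cornerProj_op_smul, this]
    rfl

/-- The elements `1_A` and `1` have the same component in `A`, so under `hX` the idempotent `1_A`
acts on the right as the identity. An element `y` commuting with `E` then satisfies `1_A y = y 1_A =
y` and lies in the corner. Conversely, on a corner element both actions of `E` are through `A`, so
commuting with `A` suffices. -/
theorem isQuasiIsoAt_restrictCorner_zero
    (hX : ∀ (x : Triangular A M B) (y : X), op x • y = op (inclA M B x.a) • y) :
    IsQuasiIsoAt (Hochschild.d k (Triangular A M B) X) (Hochschild.d k A (XAA k A M B X))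
      (restrictCorner k A M B X) 0 where
  injective f hf h := by
    have hz := (Hochschild.d_zero_eq_zero_iff f Fin.elim0).1 hf
    have h1 : op (eA A M B) • f Fin.elim0 = f Fin.elim0 := by
      rw [hX, show (eA A M B).a = (1 : Triangular A M B).a from rfl, ← hX, op_one, one_smul]
    have h2 : cornerProj k A M B X (f Fin.elim0) = 0 := by
      have := congrArg (fun F => F Fin.elim0) (show restrictCorner k A M B X 0 f = 0 from h)
      exact (congrArg _ (congrArg f (Subsingleton.elim _ _))).trans this
    have h3 : f Fin.elim0 = 0 := by
      have := congrArg Subtype.val h2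
      rw [coe_cornerProj, h1, hz, h1] at this
      exact this
    change f = 0
    ext g
    rw [Subsingleton.elim g Fin.elim0, h3, zero_apply]
  surjective b hb := by
    have hz := (Hochschild.d_zero_eq_zero_iff b Fin.elim0).1 hb
    refine ⟨MultilinearMap.constOfIsEmpty k _ (b Fin.elim0 : X),
      (Hochschild.d_zero_eq_zero_iff _ Fin.elim0).2 fun x => ?_, ?_⟩
    · change x • (b Fin.elim0 : X) = op x • (b Fin.elim0 : X)
      rw [smul_coe_XAA, hX, ← XAA.coe_smul, hz, XAA.coe_op_smul]
    · have : b = restrictCorner k A M B X 0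
          (MultilinearMap.constOfIsEmpty k _ (b Fin.elim0 : X)) := by
        ext g
        rw [Subsingleton.elim g Fin.elim0]
        exact congrArg Subtype.val (cornerProj_coe (b Fin.elim0)).symm
      rw [← this, sub_self]
      exact zero_mem _

end

section Map

variable {X Y : Type*}
  [AddCommGroup X] [Module k X] [Module (Triangular A M B) X] [Module (Triangular A M B)ᵐᵒᵖ X]
  [SMulCommClass (Triangular A M B) (Triangular A M B)ᵐᵒᵖ X]
  [IsScalarTower k (Triangular A M B) X] [IsScalarTower k (Triangular A M B)ᵐᵒᵖ X]
  [AddCommGroup Y] [Module k Y] [Module (Triangular A M B) Y] [Module (Triangular A M B)ᵐᵒᵖ Y]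
  [SMulCommClass (Triangular A M B) (Triangular A M B)ᵐᵒᵖ Y]
  [IsScalarTower k (Triangular A M B) Y] [IsScalarTower k (Triangular A M B)ᵐᵒᵖ Y]

/-- The map of corners `x ↦ 1_A f(x) 1_A` given by a `k`-linear map of bimodules. -/
def cornerMap (f : X →ₗ[k] Y) : XAA k A M B X →ₗ[k] XAA k A M B Y :=
  cornerProj k A M B Y ∘ₗ f ∘ₗ (XAA k A M B X).subtype

theorem cornerMap_apply (f : X →ₗ[k] Y) (x : XAA k A M B X) :
    cornerMap f x = cornerProj k A M B Y (f x) := rfl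

theorem cornerMap_cornerProj {f : X →ₗ[k] Y}
    (hl : ∀ (a : Triangular A M B) x, f (a • x) = a • f x)
    (hr : ∀ (a : Triangular A M B) x, f (op a • x) = op a • f x) (x : X) :
    cornerMap f (cornerProj k A M B X x) = cornerProj k A M B Y (f x) := by
  rw [cornerMap_apply, coe_cornerProj, hl, hr, ← coe_cornerProj (k := k), cornerProj_coe]

theorem cornerMap_smul {f : X →ₗ[k] Y} (hl : ∀ (a : Triangular A M B) x, f (a • x) = a • f x)
    (a : A) (x : XAA k A M B X) : cornerMap f (a • x) = a • cornerMap f x := by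
  rw [cornerMap_apply, XAA.coe_smul, hl, cornerProj_smul, cornerMap_apply]

theorem cornerMap_op_smul {f : X →ₗ[k] Y}
    (hr : ∀ (a : Triangular A M B) x, f (op a • x) = op a • f x) (a : A) (x : XAA k A M B X) :
    cornerMap f (op a • x) = op a • cornerMap f x := by
  rw [cornerMap_apply, XAA.coe_op_smul, hr, cornerProj_op_smul, cornerMap_apply]

end Map

/-- Cutting by `1_A` on both sides is exact. The maps `ρ` and `σ` need not preserve corners, but
their compressions `cornerMap ρ` and `cornerMap σ` still split the sequence, because `ι` and `π`
commute with `cornerProj`. -/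
theorem isShortExactComplex_cornerMap {X' X X'' : Type*}
    [AddCommGroup X'] [Module k X'] [Module (Triangular A M B) X']
    [Module (Triangular A M B)ᵐᵒᵖ X'] [SMulCommClass (Triangular A M B) (Triangular A M B)ᵐᵒᵖ X']
    [IsScalarTower k (Triangular A M B) X'] [IsScalarTower k (Triangular A M B)ᵐᵒᵖ X']
    [AddCommGroup X] [Module k X] [Module (Triangular A M B) X]
    [Module (Triangular A M B)ᵐᵒᵖ X] [SMulCommClass (Triangular A M B) (Triangular A M B)ᵐᵒᵖ X]
    [IsScalarTower k (Triangular A M B) X] [IsScalarTower k (Triangular A M B)ᵐᵒᵖ X]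
    [AddCommGroup X''] [Module k X''] [Module (Triangular A M B) X'']
    [Module (Triangular A M B)ᵐᵒᵖ X''] [SMulCommClass (Triangular A M B) (Triangular A M B)ᵐᵒᵖ X'']
    [IsScalarTower k (Triangular A M B) X''] [IsScalarTower k (Triangular A M B)ᵐᵒᵖ X'']
    {ι : X' →ₗ[k] X} {π : X →ₗ[k] X''} {ρ : X →ₗ[k] X'} {σ : X'' →ₗ[k] X}
    (hιl : ∀ (a : Triangular A M B) x, ι (a • x) = a • ι x)
    (hιr : ∀ (a : Triangular A M B) x, ι (op a • x) = op a • ι x)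
    (hπl : ∀ (a : Triangular A M B) x, π (a • x) = a • π x)
    (hπr : ∀ (a : Triangular A M B) x, π (op a • x) = op a • π x)
    (hρ : ∀ x, ρ (ι x) = x) (hσ : ∀ x, π (σ x) = x) (hπι : ∀ x, π (ι x) = 0)
    (hex : ∀ x, π x = 0 → ι (ρ x) = x) :
    IsShortExactComplex (Hochschild.d k A (XAA k A M B X')) (Hochschild.d k A (XAA k A M B X))
      (Hochschild.d k A (XAA k A M B X'')) (Hochschild.coeffMap A (cornerMap ι))
      (Hochschild.coeffMap A (cornerMap π)) := by
  have coe_map : ∀ x : XAA k A M B X', (cornerMap ι x : X) = ι x := fun x => by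
    rw [cornerMap_apply, coe_cornerProj, ← hιr, ← hιl, op_eA_smul_of_mem, eA_smul_of_mem]
  have coe_map' : ∀ x : XAA k A M B X, (cornerMap π x : X'') = π x := fun x => by
    rw [cornerMap_apply, coe_cornerProj, ← hπr, ← hπl, op_eA_smul_of_mem, eA_smul_of_mem]
  refine Hochschild.isShortExactComplex_coeffMap (ρ := cornerMap ρ) (σ := cornerMap σ)
    (cornerMap_smul hιl) (cornerMap_op_smul hιr) (cornerMap_smul hπl) (cornerMap_op_smul hπr)
    (fun x => ?_) (fun x => ?_) (fun x => ?_) (fun x hx => ?_)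
  · rw [cornerMap_apply, coe_map, hρ, cornerProj_coe]
  · rw [cornerMap_apply σ, cornerMap_cornerProj hπl hπr, hσ, cornerProj_coe]
  · exact Subtype.ext (by rw [coe_map', coe_map, hπι]; rfl)
  · have : π x = 0 := by rw [← coe_map', hx]; rfl
    rw [cornerMap_apply ρ, cornerMap_cornerProj hιl hιr, hex _ this, cornerProj_coe]

end Corner

/-! ### Cohomology of bimodules on which the right action is through `A` -/

section RestrictCorner

universe u₁ u₂ u₃ u₄ u₅

variable {k : Type u₁} {A : Type u₂} {M : Type u₃} {B : Type u₄}
  [CommRing k] [Ring A] [Algebra k A] [Ring B] [Algebra k B]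
  [AddCommGroup M] [Module k M] [Module A M] [Module Bᵐᵒᵖ M] [SMulCommClass A Bᵐᵒᵖ M]
  [IsScalarTower k A M] [IsScalarTower k Bᵐᵒᵖ M]

theorem isQuasiIsoAt_restrictCorner_inflation_zero (Z : Type*) [AddCommGroup Z] [Module k Z]
    [Module (Triangular A M B ⊗[k] Aᵐᵒᵖ) Z] [IsScalarTower k (Triangular A M B ⊗[k] Aᵐᵒᵖ) Z] :
    IsQuasiIsoAt (Hochschild.d k (Triangular A M B) (Inflation (projAAlgHom k A M B) Z))
      (Hochschild.d k A (XAA k A M B (Inflation (projAAlgHom k A M B) Z)))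
      (restrictCorner k A M B (Inflation (projAAlgHom k A M B) Z)) 0 :=
  isQuasiIsoAt_restrictCorner_zero fun _ _ => rfl

/-- Dimension shifting over `E ⊗ Aᵒᵖ`: the coinduced module is acyclic over `E`, and its corner is
acyclic over `A`. -/
theorem isQuasiIsoAt_restrictCorner_succ (Z : Type*) [AddCommGroup Z] [Module k Z]
    [Module (Triangular A M B ⊗[k] Aᵐᵒᵖ) Z] [IsScalarTower k (Triangular A M B ⊗[k] Aᵐᵒᵖ) Z] (n : ℕ)
    (h : IsQuasiIsoAt (Hochschild.d k (Triangular A M B) (Inflation (projAAlgHom k A M B)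
        (Coinduced.Cokernel k (Triangular A M B ⊗[k] Aᵐᵒᵖ) Z)))
      (Hochschild.d k A (XAA k A M B (Inflation (projAAlgHom k A M B)
        (Coinduced.Cokernel k (Triangular A M B ⊗[k] Aᵐᵒᵖ) Z))))
      (restrictCorner k A M B _) n) :
    IsQuasiIsoAt (Hochschild.d k (Triangular A M B) (Inflation (projAAlgHom k A M B) Z))
      (Hochschild.d k A (XAA k A M B (Inflation (projAAlgHom k A M B) Z)))
      (restrictCorner k A M B (Inflation (projAAlgHom k A M B) Z)) (n + 1) := by
  obtain ⟨ρ, σ, hρ, hσ, hπι, hex⟩ := Inflation.exists_coinduced_splitting (projAAlgHom k A M B) Z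
  refine IsQuasiIsoAt.succ_of_isShortExactComplex
    (Inflation.isShortExactComplex_coinduced (projAAlgHom k A M B))
    (isShortExactComplex_cornerMap (Inflation.map_smul _ _) (Inflation.map_op_smul _ _)
      (Inflation.map_smul _ _) (Inflation.map_op_smul _ _) hρ hσ hπι hex)
    d_restrictCorner (fun n f => ?_) (fun n f => ?_) Hochschild.d_d_apply Hochschild.d_d_apply
    (Inflation.isAcyclicPos_coinduced _ _)
    (isAcyclicPos_corner (Inflation.isCoinducedRetraction_coinducedRetraction _))
    (isQuasiIsoAt_restrictCorner_inflation_zero _) n h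
  · refine MultilinearMap.ext fun g => ?_
    exact cornerMap_cornerProj (Inflation.map_smul _ _) (Inflation.map_op_smul _ _) _
  · refine MultilinearMap.ext fun g => ?_
    exact cornerMap_cornerProj (Inflation.map_smul _ _) (Inflation.map_op_smul _ _) _

/-- As for Ext, the universe is chosen to be stable under passing to the cokernel. -/
theorem isQuasiIsoAt_restrictCorner_of_large (n : ℕ) (Z : Type (max u₂ u₃ u₄ u₅)) [AddCommGroup Z]
    [Module k Z] [Module (Triangular A M B ⊗[k] Aᵐᵒᵖ) Z]
    [IsScalarTower k (Triangular A M B ⊗[k] Aᵐᵒᵖ) Z] :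
    IsQuasiIsoAt (Hochschild.d k (Triangular A M B) (Inflation (projAAlgHom k A M B) Z))
      (Hochschild.d k A (XAA k A M B (Inflation (projAAlgHom k A M B) Z)))
      (restrictCorner k A M B (Inflation (projAAlgHom k A M B) Z)) n := by
  induction n generalizing Z with
  | zero => exact isQuasiIsoAt_restrictCorner_inflation_zero Z
  | succ n ih => exact isQuasiIsoAt_restrictCorner_succ Z n (ih _)

theorem nonempty_H_inflation_linearEquiv (Z : Type u₅) [AddCommGroup Z]
    [Module k Z] [Module (Triangular A M B ⊗[k] Aᵐᵒᵖ) Z]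
    [IsScalarTower k (Triangular A M B ⊗[k] Aᵐᵒᵖ) Z] (n : ℕ) :
    Nonempty (Hochschild.H k (Triangular A M B) (Inflation (projAAlgHom k A M B) Z) n ≃ₗ[k]
      Hochschild.H k A (XAA k A M B (Inflation (projAAlgHom k A M B) Z)) n) := by
  refine IsQuasiIsoAt.nonempty_linearEquiv d_restrictCorner
    (g := restrictCorner k A M B (Inflation (projAAlgHom k A M B) Z)) ?_
  cases n with
  | zero => exact isQuasiIsoAt_restrictCorner_inflation_zero Z
  | succ n =>
    exact isQuasiIsoAt_restrictCorner_succ Z n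
      (isQuasiIsoAt_restrictCorner_of_large.{u₁, u₂, u₃, u₄, u₅} n _)

end RestrictCorner

/-! ### The module `X 1_A` -/

section X1A

set_option linter.unusedSectionVars false

variable (k A M B X : Type*) [CommRing k] [Ring A] [Algebra k A] [Ring B] [Algebra k B]
  [AddCommGroup M] [Module k M] [Module A M] [Module Bᵐᵒᵖ M] [SMulCommClass A Bᵐᵒᵖ M]
  [IsScalarTower k A M] [IsScalarTower k Bᵐᵒᵖ M]
  [AddCommGroup X] [Module k X] [Module (Triangular A M B) X] [Module (Triangular A M B)ᵐᵒᵖ X]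
  [SMulCommClass (Triangular A M B) (Triangular A M B)ᵐᵒᵖ X]
  [IsScalarTower k (Triangular A M B) X] [IsScalarTower k (Triangular A M B)ᵐᵒᵖ X]

/-- `X 1_A`, a left submodule of the `E`-bimodule `X`. -/
def X1A : Submodule (Triangular A M B) X where
  carrier := {x | ∃ y : X, op (eA A M B) • y = x}
  zero_mem' := ⟨0, smul_zero _⟩
  add_mem' := by
    rintro _ _ ⟨y, rfl⟩ ⟨z, rfl⟩
    exact ⟨y + z, smul_add _ _ _⟩
  smul_mem' := by
    rintro e _ ⟨y, rfl⟩
    exact ⟨e • y, (smul_comm _ _ _).symm⟩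

variable {k A M B X}

theorem X1A.op_eA_smul_of_mem (x : X1A A M B X) : op (eA A M B) • (x : X) = x := by
  obtain ⟨_, y, rfl⟩ := x
  change op (eA A M B) • op (eA A M B) • y = op (eA A M B) • y
  rw [smul_smul, ← op_mul, mul_eA]
  rfl

/-- The right action of `A` on `X 1_A`. -/
instance : Module Aᵐᵒᵖ (X1A A M B X) where
  smul a x := ⟨op (inclA M B a.unop) • (x : X), op (inclA M B a.unop) • (x : X), by
    rw [smul_smul, ← op_mul, mul_eA, inclA_a]⟩
  one_smul x := Subtype.ext (X1A.op_eA_smul_of_mem x)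
  mul_smul b c x := Subtype.ext <| by
    change op (inclA M B (b * c).unop) • (x : X) =
      op (inclA M B b.unop) • op (inclA M B c.unop) • (x : X)
    rw [unop_mul, map_mul, op_mul, mul_smul]
  smul_zero b := Subtype.ext (smul_zero _)
  smul_add b x y := Subtype.ext (smul_add _ _ _)
  add_smul b c x := Subtype.ext <| by
    change op (inclA M B (b + c).unop) • (x : X) =
      op (inclA M B b.unop) • (x : X) + op (inclA M B c.unop) • (x : X)
    rw [unop_add, map_add, op_add, add_smul]
  zero_smul x := Subtype.ext <| by
    change op (inclA M B (0 : Aᵐᵒᵖ).unop) • (x : X) = 0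
    rw [unop_zero, map_zero, op_zero, zero_smul]

instance : IsScalarTower k Aᵐᵒᵖ (X1A A M B X) :=
  ⟨fun c b x => Subtype.ext <| by
    change op (inclA M B (c • b).unop) • (x : X) = c • op (inclA M B b.unop) • (x : X)
    rw [← smul_assoc, ← op_smul]
    congr 2
    ext <;> simp⟩

instance : SMulCommClass (Triangular A M B) Aᵐᵒᵖ (X1A A M B X) :=
  ⟨fun e b x => Subtype.ext (smul_comm e (op (inclA M B b.unop)) (x : X))⟩

instance : Module (Triangular A M B ⊗[k] Aᵐᵒᵖ) (X1A A M B X) := TensorProduct.Algebra.module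

instance : IsScalarTower k (Triangular A M B ⊗[k] Aᵐᵒᵖ) (X1A A M B X) := isScalarTower_tensor

variable (k A M B X) in
/-- The inclusion of `X 1_B` in `X`. -/
def inclX1B : Inflation (projBAlgHom k A M B) (X1B A M B X) →ₗ[k] X :=
  (X1B A M B X).subtype.restrictScalars k ∘ₗ
    (Inflation.equiv (projBAlgHom k A M B)).symm.toLinearMap

variable (k A M B X) in
/-- The inclusion of `X 1_A` in `X`. -/
def inclX1A : Inflation (projAAlgHom k A M B) (X1A A M B X) →ₗ[k] X :=
  (X1A A M B X).subtype.restrictScalars k ∘ₗ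
    (Inflation.equiv (projAAlgHom k A M B)).symm.toLinearMap

variable (k A M B X) in
/-- The projection `x ↦ x 1_B`. -/
def projX1B : X →ₗ[k] Inflation (projBAlgHom k A M B) (X1B A M B X) :=
  (Inflation.equiv (projBAlgHom k A M B)).toLinearMap ∘ₗ
    (Algebra.lsmul k k X (op (eB A M B))).codRestrict ((X1B A M B X).restrictScalars k)
      fun x => ⟨x, rfl⟩

variable (k A M B X) in
/-- The projection `x ↦ x 1_A`. -/
def projX1A : X →ₗ[k] Inflation (projAAlgHom k A M B) (X1A A M B X) :=
  (Inflation.equiv (projAAlgHom k A M B)).toLinearMap ∘ₗ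
    (Algebra.lsmul k k X (op (eA A M B))).codRestrict ((X1A A M B X).restrictScalars k)
      fun x => ⟨x, rfl⟩

theorem inclX1A_injective : Function.Injective (inclX1A k A M B X) := Subtype.val_injective

theorem inclX1B_injective : Function.Injective (inclX1B k A M B X) := Subtype.val_injective

theorem inclX1A_projX1A (x : X) : inclX1A k A M B X (projX1A k A M B X x) = op (eA A M B) • x :=
  rfl

theorem inclX1B_projX1B (x : X) : inclX1B k A M B X (projX1B k A M B X x) = op (eB A M B) • x :=
  rfl

theorem op_eB_smul_inclX1B (y : Inflation (projBAlgHom k A M B) (X1B A M B X)) :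
    op (eB A M B) • inclX1B k A M B X y = inclX1B k A M B X y := eB_smul_of_mem _

theorem op_eA_smul_inclX1A (y : Inflation (projAAlgHom k A M B) (X1A A M B X)) :
    op (eA A M B) • inclX1A k A M B X y = inclX1A k A M B X y := X1A.op_eA_smul_of_mem _

theorem inclX1B_smul (e : Triangular A M B) (y : Inflation (projBAlgHom k A M B) (X1B A M B X)) :
    inclX1B k A M B X (e • y) = e • inclX1B k A M B X y :=
  congrArg (e • ·) (op_eB_smul_inclX1B y)

/-- For `y` in `X 1_B`, `y e = y 1_B e` and `1_B e` is the component of `e` in `B`. Hence `X 1_B` is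
a sub-bimodule, with right action through `B`. -/
theorem inclX1B_op_smul (e : Triangular A M B)
    (y : Inflation (projBAlgHom k A M B) (X1B A M B X)) :
    inclX1B k A M B X (op e • y) = op e • inclX1B k A M B X y := by
  -- On the inflation, `op e` acts as the pure tensor `1 ⊗ e.b`, whence the extra factor `1`.
  have h : inclX1B k A M B X (op e • y) =
      (1 : Triangular A M B) • op (inclB A M e.b) • inclX1B k A M B X y := rfl
  rw [h, one_smul, ← eB_mul, op_mul, mul_smul, op_eB_smul_inclX1B]

theorem inclX1A_smul (e : Triangular A M B) (y : Inflation (projAAlgHom k A M B) (X1A A M B X)) :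
    inclX1A k A M B X (e • y) = e • inclX1A k A M B X y :=
  congrArg (e • ·) (op_eA_smul_inclX1A y)

theorem projX1A_smul (e : Triangular A M B) (x : X) :
    projX1A k A M B X (e • x) = e • projX1A k A M B X x :=
  inclX1A_injective (by
    rw [inclX1A_smul, inclX1A_projX1A, inclX1A_projX1A, smul_comm e])

/-- Both sides equal `x` multiplied on the right by the component of `e` in `A`, since `e 1_A = 1_A
(e 1_A)`. This makes `X 1_A` a quotient bimodule of `X`. -/
theorem projX1A_op_smul (e : Triangular A M B) (x : X) :
    projX1A k A M B X (op e • x) = op e • projX1A k A M B X x := by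
  apply inclX1A_injective
  have h : inclX1A k A M B X (op e • projX1A k A M B X x) =
      (1 : Triangular A M B) • op (inclA M B e.a) • op (eA A M B) • x := rfl
  rw [h, one_smul, inclX1A_projX1A, smul_smul, smul_smul, ← op_mul, ← op_mul, mul_eA,
    eA_mul_inclA]

theorem projX1B_inclX1B (y : Inflation (projBAlgHom k A M B) (X1B A M B X)) :
    projX1B k A M B X (inclX1B k A M B X y) = y :=
  inclX1B_injective (op_eB_smul_inclX1B y)

theorem projX1A_inclX1A (y : Inflation (projAAlgHom k A M B) (X1A A M B X)) :
    projX1A k A M B X (inclX1A k A M B X y) = y :=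
  inclX1A_injective (op_eA_smul_inclX1A y)

theorem projX1A_inclX1B (y : Inflation (projBAlgHom k A M B) (X1B A M B X)) :
    projX1A k A M B X (inclX1B k A M B X y) = 0 :=
  inclX1A_injective (by
    rw [inclX1A_projX1A, ← op_eB_smul_inclX1B, smul_smul, ← op_mul, eB_mul_eA, op_zero, zero_smul,
      map_zero])

theorem inclX1B_projX1B_of_projX1A_eq_zero (x : X) (hx : projX1A k A M B X x = 0) :
    inclX1B k A M B X (projX1B k A M B X x) = x := by
  have h : op (eA A M B) • x = 0 := by rw [← inclX1A_projX1A (k := k), hx, map_zero]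
  have h' : op (eA A M B + eB A M B) • x = x := by rw [eA_add_eB, op_one, one_smul]
  rw [op_add, add_smul, h, zero_add] at h'
  rw [inclX1B_projX1B, h']

variable (k A M B X) in
-- The bimodules `X` and `X 1_A` have the same corner, as `1_A (X 1_A) 1_A = 1_A X 1_A`; `projX1A`
-- and `inclX1A` induce mutually inverse maps of corners.
theorem nonempty_H_corner_X1A_linearEquiv (n : ℕ) :
    Nonempty (Hochschild.H k A (XAA k A M B X) n ≃ₗ[k] Hochschild.H k A
      (XAA k A M B (Inflation (projAAlgHom k A M B) (X1A A M B X))) n) := by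
  have hg := Hochschild.d_cochainMap (k := k) (α := (LinearMap.id : A →ₗ[k] A)) (fun _ _ => rfl)
    (cornerMap_smul (projX1A_smul (k := k) (A := A) (M := M) (B := B) (X := X)))
    (cornerMap_op_smul projX1A_op_smul)
  refine IsQuasiIsoAt.nonempty_linearEquiv hg (IsQuasiIsoAt.of_bijective hg (fun n => ?_) n)
  refine Function.bijective_iff_has_inverse.2
    ⟨Hochschild.coeffMap A (cornerMap (inclX1A k A M B X)) n,
      Hochschild.coeffMap_coeffMap (fun x => ?_) n, Hochschild.coeffMap_coeffMap (fun x => ?_) n⟩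
  · have : (cornerMap (projX1A k A M B X) x : Inflation (projAAlgHom k A M B) (X1A A M B X)) =
        projX1A k A M B X x := by
      rw [cornerMap_apply, coe_cornerProj, ← projX1A_op_smul, ← projX1A_smul, op_eA_smul_of_mem,
        eA_smul_of_mem]
    rw [cornerMap_apply, this, inclX1A_projX1A, op_eA_smul_of_mem, cornerProj_coe]
  · rw [cornerMap_apply (inclX1A k A M B X), cornerMap_cornerProj projX1A_smul projX1A_op_smul,
      projX1A_inclX1A, cornerProj_coe]

end X1A

/-! ### The long exact sequence of `X 1_B → X → X 1_A` -/

theorem theorem2 {k A M B X : Type*} [CommRing k] [Ring A] [Algebra k A] [Ring B] [Algebra k B]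
    [AddCommGroup M] [Module k M] [Module A M] [Module Bᵐᵒᵖ M] [SMulCommClass A Bᵐᵒᵖ M]
    [IsScalarTower k A M] [IsScalarTower k Bᵐᵒᵖ M]
    [AddCommGroup X] [Module k X] [Module (Triangular A M B) X] [Module (Triangular A M B)ᵐᵒᵖ X]
    [SMulCommClass (Triangular A M B) (Triangular A M B)ᵐᵒᵖ X]
    [IsScalarTower k (Triangular A M B) X] [IsScalarTower k (Triangular A M B)ᵐᵒᵖ X] :
    ∃ (i : ∀ n, RelExt k (Triangular A M B ⊗[k] Bᵐᵒᵖ) (BE A M B) (X1B A M B X) n →ₗ[k]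
          Hochschild.H k (Triangular A M B) X n)
      (j : ∀ n, Hochschild.H k (Triangular A M B) X n →ₗ[k] Hochschild.H k A (XAA k A M B X) n)
      (δ : ∀ n, Hochschild.H k A (XAA k A M B X) n →ₗ[k]
          RelExt k (Triangular A M B ⊗[k] Bᵐᵒᵖ) (BE A M B) (X1B A M B X) (n + 1)),
      Function.Injective (i 0) ∧
      ∀ n, Function.Exact (i n) (j n) ∧ Function.Exact (j n) (δ n) ∧
        Function.Exact (δ n) (i (n + 1)) := by
  -- `e` identifies the Ext term with `H(E, X 1_B)`, and `f` identifies `H(E, X 1_A)` with `H(A,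
  -- X_AA)` through the corner of `X 1_A`.
  have e := fun n => (nonempty_relExt_linearEquiv (k := k) (A := A) (M := M) (B := B)
    (X1B A M B X) n).some
  have f := fun n => ((nonempty_H_inflation_linearEquiv (k := k) (A := A) (M := M) (B := B)
    (X1A A M B X) n).some).trans (nonempty_H_corner_X1A_linearEquiv k A M B X n).some.symm
  -- The maps `projX1B` and `inclX1A` serve only as a `k`-linear splitting: `X 1_A` is in general
  -- not stable under the right action of `E` on `X`, as multiplication by `M` carries it into `X
  -- 1_B`.
  obtain ⟨i, j, δ, hi, h⟩ := exists_long_exact_sequence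
    (Hochschild.isShortExactComplex_coeffMap inclX1B_smul inclX1B_op_smul
      projX1A_smul projX1A_op_smul projX1B_inclX1B projX1A_inclX1A projX1A_inclX1B
      (inclX1B_projX1B_of_projX1A_eq_zero (k := k) (A := A) (M := M) (B := B) (X := X)))
    Hochschild.d_d_apply (Hochschild.coeffMap _ (projX1B k A M B X))
    (Hochschild.coeffMap _ (inclX1A k A M B X))
    (Hochschild.coeffMap_coeffMap projX1B_inclX1B) (Hochschild.coeffMap_coeffMap projX1A_inclX1A)
  refine ⟨fun n => i n ∘ₗ (e n).toLinearMap, fun n => (f n).toLinearMap ∘ₗ j n,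
    fun n => (e (n + 1)).symm.toLinearMap ∘ₗ δ n ∘ₗ (f n).symm.toLinearMap,
    hi.comp (e 0).injective, fun n => ⟨?_, ?_, ?_⟩⟩
  · refine Function.Exact.of_ladder_linearEquiv_of_exact (e₁ := (e n).symm)
      (e₂ := LinearEquiv.refl k _) (e₃ := f n) ?_ ?_ (h n).1
    · ext; simp
    · ext; simp
  · refine Function.Exact.of_ladder_linearEquiv_of_exact (e₁ := LinearEquiv.refl k _)
      (e₂ := f n) (e₃ := (e (n + 1)).symm) ?_ ?_ (h n).2.1
    · ext; simp
    · ext; simp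
  · refine Function.Exact.of_ladder_linearEquiv_of_exact (e₁ := f n)
      (e₂ := (e (n + 1)).symm) (e₃ := LinearEquiv.refl k _) ?_ ?_ (h n).2.2
    · ext; simp
    · ext; simp
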